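/- Let $\mathbb K=\mathbb R$ or $\mathbb C$, let $n\ge 1$, and let $X=\sum_j X_j\,\partial/\partial x_j$, $X_j\in\mathbb K[[x_1,\dots,x_n]]$, be a formal vector field on $(\mathbb K^n,0)$ with $X(0)=0$. Let $A\in\mathfrak{gl}_n(\mathbb K)$ be its Jacobian matrix at $0$ and $X^{(1)}=\sum_{j}\big(\sum_i A_{ji}x_i\big)\partial/\partial x_j$ its linear part. Let $\Omega=dx_1\wedge\dots\wedge dx_n$. A formal $p$-form $\eta$ is an infinitesimal deformation of an integrable formal $p$-form $\omega$ if $i_A\omega\wedge\eta+i_A\eta\wedge\omega=0$ and $i_A\omega\wedge d\eta+i_A\eta\wedge d\omega=0$ for every formal $(p-1)$-vector field $A$ (no condition if $p=0$). For a formal vector field $V$ with $V(0)=0$ let $\mathcal Z(V)$ be the space of formal vector fields $Y$ such that the $(n-1)$-form $i_Y\Omega$ is an infinitesimal deformation of $i_V\Omega$, let $\mathcal B(V)=\{\mathcal L_ZV : Z \text{ a formal vector field}\}$ and $\mathcal B(\mathcal F_V)=\{\mathcal L_ZV+fV : Z\text{ a formal vector field},\ f\in\mathbb K[[x_1,\dots,x_n]]\}$,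 and put $$DH(V)=\mathcal Z(V)/\mathcal B(V),\qquad DH(\mathcal F_V)=\mathcal Z(V)/\mathcal B(\mathcal F_V).$$ (The fields $Y$, $Z$ need not vanish at $0$.) Let $DH_{lin}(X^{(1)})$ be the space of linear vector fields in $\mathcal Z(X^{(1)})$ modulo the space of linear vector fields in $\mathcal B(X^{(1)})$. Suppose that $X^{(1)}$ is non-resonant: if $\lambda_1,\dots,\lambda_n$ are the eigenvalues of $A$ (in an algebraic closure of $\mathbb K$, with multiplicity), there is no relation $\lambda_j=\sum_i m_i\lambda_i$ with integers $m_i\ge0$ and $\sum_i m_i\ge2$. Then: (i) $DH(X)= DH_{lin}(X^{(1)})$, in the sense that the inclusion of the linear vector fields into the formal vector fields induces an isomorphism of vector spaces $DH_{lin}(X^{(1)})\to DH(X)$; the spaces $DH_{lin}(X^{(1)})$ and $DH(\mathcal F_X)$ are finite-dimensional, and $\dim DH(\mathcal F_X)=\dim DH_{lin}(X^{(1)})-1$. (ii) The adjoint orbit $\{gAg^{-1}: g\in GL_n(\mathbb K)\}$ is a smooth embedded submanifold of $\mathfrak{gl}_n(\mathbb K)$ (complex submanifold if $\mathbb K=\mathbb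 C$) and, $d$ being its dimension over $\mathbb K$, $\dim DH_{lin}(X^{(1)})=n^2-d\ge n$. (iii) If the eigenvalues $\lambda_1,\dots,\lambda_n$ are pairwise distinct, then $\dim DH_{lin}(X^{(1)})=n$. -/

import Mathlib

namespace DefCoh

open scoped Topology

noncomputable section

/-! ### Formal functions and formal vector fields on `(Kⁿ, 0)` -/

/-- Formal functions at the origin of `Kⁿ`: formal power series in `x₁, …, xₙ`. -/
abbrev Fun (K : Type*) [Field K] (n : ℕ) := MvPowerSeries (Fin n) K

/-- Formal vector fields: `X` stands for `∑ j, X j ∂/∂xⱼ`. -/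
abbrev VF (K : Type*) [Field K] (n : ℕ) := Fin n → Fun K n

/-- The components `ω (∂_{I 0}, …, ∂_{I (p-1)})` of a formal differential `p`-form `ω`
with respect to the coordinate vector fields. -/
abbrev FormComp (K : Type*) [Field K] (n p : ℕ) := (Fin p → Fin n) → Fun K n

variable {K : Type*} [Field K] {n : ℕ}

/-- The partial derivative `∂f/∂xᵢ`. -/
abbrev pd (i : Fin n) (f : Fun K n) : Fun K n := MvPowerSeries.pderiv K i f

/-- The Lie bracket `[Z, X] = ∑ j, (∑ i, Zᵢ ∂ᵢXⱼ - Xᵢ ∂ᵢZⱼ) ∂/∂xⱼ`,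
which is the Lie derivative `L_Z X`. -/
def bracket (Z X : VF K n) : VF K n :=
  fun j => ∑ i, (Z i * pd i (X j) - X i * pd i (Z j))

/-! ### Differential forms in components -/

/-- Exterior derivative:
`(dη)(∂_{I 0}, …, ∂_{I p}) = ∑ k, (-1)^k ∂_{I k} (η (∂_{I 0}, …, omit k, …, ∂_{I p}))`. -/
def extDer {p : ℕ} (η : FormComp K n p) : FormComp K n (p + 1) :=
  fun I => ∑ k : Fin (p + 1), (-1) ^ (k : ℕ) * pd (I k) (η fun l => I (k.succAbove l))

/-- Exterior product `α ∧ η` of a 1-form `α`, given by its components, with a `p`-form `η`. -/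
def wedge {p : ℕ} (α : Fin n → Fun K n) (η : FormComp K n p) : FormComp K n (p + 1) :=
  fun I => ∑ k : Fin (p + 1), (-1) ^ (k : ℕ) * α (I k) * η fun l => I (k.succAbove l)

/-- The 1-form `i_A ω` for an `(r+1)`-form `ω` and an `r`-vector field
`A = ∑ J, A_J ∂_{J 0} ∧ ⋯ ∧ ∂_{J (r-1)}`. -/
def contract {r : ℕ} (A : (Fin r → Fin n) → Fun K n) (ω : FormComp K n (r + 1)) :
    Fin n → Fun K n :=
  fun k => ∑ J : Fin r → Fin n, A J * ω (Fin.snoc J k)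

/-- `η` is an infinitesimal deformation of the integrable `p`-form `ω`, i.e. `ω + ε η` is
integrable modulo `ε²`: for every `(p-1)`-vector field `A`,
`i_A ω ∧ η + i_A η ∧ ω = 0` and `i_A ω ∧ dη + i_A η ∧ dω = 0`.
For `p = 0` there is no `A` and no condition. -/
def IsInfDeformation : {p : ℕ} → FormComp K n p → FormComp K n p → Prop
  | 0, _, _ => True
  | r + 1, ω, η => ∀ A : (Fin r → Fin n) → Fun K n,
      wedge (contract A ω) η + wedge (contract A η) ω = 0 ∧
      wedge (contract A ω) (extDer η) + wedge (contract A η) (extDer ω) = 0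

/-- The `p`-form `i_X Ω`, where `Ω = dx₁ ∧ ⋯ ∧ dxₙ` and `p + 1 = n`:
`(i_X Ω)(∂_{I 0}, …, ∂_{I (p-1)}) = Ω (X, ∂_{I 0}, …, ∂_{I (p-1)})`
is the determinant with rows `X, ∂_{I 0}, …, ∂_{I (p-1)}`. -/
def volContract {p : ℕ} (h : n = p + 1) (X : VF K n) : FormComp K n p :=
  fun I => Matrix.det (Matrix.of fun r : Fin n =>
    (Fin.cons X (fun l => Pi.single (I l) 1) : Fin (p + 1) → VF K n) (Fin.cast h r))

/-! ### Linearity facts -/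

lemma extDer_add {p : ℕ} (η θ : FormComp K n p) : extDer (η + θ) = extDer η + extDer θ := by
  funext I
  simp [extDer, mul_add, Finset.sum_add_distrib]

lemma extDer_smul {p : ℕ} (c : K) (η : FormComp K n p) : extDer (c • η) = c • extDer η := by
  funext I
  simp [extDer, Finset.smul_sum]

lemma wedge_add_right {p : ℕ} (α : Fin n → Fun K n) (η θ : FormComp K n p) :
    wedge α (η + θ) = wedge α η + wedge α θ := by
  funext I
  simp [wedge, mul_add, Finset.sum_add_distrib]

lemma wedge_smul_right {p : ℕ} (c : K) (α : Fin n → Fun K n) (η : FormComp K n p) :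
    wedge α (c • η) = c • wedge α η := by
  funext I
  simp [wedge, Finset.smul_sum]

lemma wedge_add_left {p : ℕ} (α β : Fin n → Fun K n) (η : FormComp K n p) :
    wedge (α + β) η = wedge α η + wedge β η := by
  funext I
  simp [wedge, mul_add, add_mul, Finset.sum_add_distrib]

lemma wedge_smul_left {p : ℕ} (c : K) (α : Fin n → Fun K n) (η : FormComp K n p) :
    wedge (c • α) η = c • wedge α η := by
  funext I
  simp [wedge, Finset.smul_sum]

lemma contract_add {r : ℕ} (A : (Fin r → Fin n) → Fun K n) (ω η : FormComp K n (r + 1)) :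
    contract A (ω + η) = contract A ω + contract A η := by
  funext k
  simp [contract, mul_add, Finset.sum_add_distrib]

lemma contract_smul {r : ℕ} (A : (Fin r → Fin n) → Fun K n) (c : K)
    (ω : FormComp K n (r + 1)) : contract A (c • ω) = c • contract A ω := by
  funext k
  simp [contract, Finset.smul_sum]

lemma IsInfDeformation.add {p : ℕ} {ω η θ : FormComp K n p} (h₁ : IsInfDeformation ω η)
    (h₂ : IsInfDeformation ω θ) : IsInfDeformation ω (η + θ) := by
  cases p with
  | zero => trivial
  | succ r =>
    intro A
    obtain ⟨a, b⟩ := h₁ A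
    obtain ⟨a', b'⟩ := h₂ A
    rw [contract_add, extDer_add, wedge_add_right, wedge_add_right, wedge_add_left,
      wedge_add_left, add_add_add_comm, a, a', add_add_add_comm, b, b']
    simp

lemma IsInfDeformation.smul {p : ℕ} {ω η : FormComp K n p} (c : K)
    (h : IsInfDeformation ω η) : IsInfDeformation ω (c • η) := by
  cases p with
  | zero => trivial
  | succ r =>
    intro A
    obtain ⟨a, b⟩ := h A
    rw [contract_smul, extDer_smul, wedge_smul_right, wedge_smul_right, wedge_smul_left,
      wedge_smul_left, ← smul_add, a, ← smul_add, b]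
    simp

lemma volContract_eq {p : ℕ} (h : n = p + 1) (X : VF K n) (I : Fin p → Fin n) :
    volContract h X I = (Matrix.updateRow (Matrix.of fun r : Fin n =>
      (Fin.cons 0 (fun l => Pi.single (I l) 1) : Fin (p + 1) → VF K n) (Fin.cast h r))
      (Fin.cast h.symm 0) X).det := by
  subst h
  unfold volContract
  congr 1
  ext r c
  refine Fin.cases ?_ (fun l => ?_) r
  · simp
  · rw [Matrix.updateRow_ne (by simp)]
    simp

lemma volContract_add {p : ℕ} (h : n = p + 1) (X Y : VF K n) :
    volContract h (X + Y) = volContract h X + volContract h Y := by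
  funext I
  simp only [volContract_eq, Pi.add_apply, Matrix.det_updateRow_add]

lemma volContract_smul {p : ℕ} (h : n = p + 1) (c : K) (X : VF K n) :
    volContract h (c • X) = c • volContract h X := by
  funext I
  have : c • X = (MvPowerSeries.C (σ := Fin n) c) • X := by
    funext j
    simp [MvPowerSeries.smul_eq_C_mul]
  simp only [this, volContract_eq, Pi.smul_apply, Matrix.det_updateRow_smul,
    MvPowerSeries.smul_eq_C_mul]

/-! ### Deformation cohomology -/

/-- `Z(X)`: the infinitesimal deformations of `X`, that is the formal vector fields `Y` such that
`i_Y Ω` is an infinitesimal deformation of `i_X Ω`. -/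
def infDefs (X : VF K n) : Submodule K (VF K n) where
  carrier := {Y | ∀ (p : ℕ) (h : n = p + 1), IsInfDeformation (volContract h X) (volContract h Y)}
  add_mem' := fun {Y Y'} hY hY' p h => by
    rw [volContract_add]
    exact (hY p h).add (hY' p h)
  zero_mem' := fun p h => by
    have := volContract_smul h (0 : K) (0 : VF K n)
    rw [zero_smul, zero_smul] at this
    rw [this]
    cases p with
    | zero => trivial
    | succ r =>
      change IsInfDeformation _ (0 : FormComp K n (r + 1))
      intro A
      have e₁ : contract A (0 : FormComp K n (r + 1)) = 0 := by
        funext k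
        simp [contract]
      have e₂ : extDer (0 : FormComp K n (r + 1)) = 0 := by
        funext I
        simp [extDer]
      rw [e₁, e₂]
      constructor <;> funext I <;> simp [wedge]
  smul_mem' := fun c Y hY p h => by
    rw [volContract_smul]
    exact (hY p h).smul c

/-- `B(X)`: the trivial deformations `L_Z X = [Z, X]` of `X`, `Z` a formal vector field. -/
def trivialDefs (X : VF K n) : Submodule K (VF K n) where
  carrier := {Y | ∃ Z : VF K n, Y = bracket Z X}
  add_mem' := by
    rintro _ _ ⟨Z, rfl⟩ ⟨Z', rfl⟩
    refine ⟨Z + Z', ?_⟩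
    funext j
    simp only [bracket, Pi.add_apply, map_add, ← Finset.sum_add_distrib]
    exact Finset.sum_congr rfl fun i _ => by ring
  zero_mem' := ⟨0, by funext j; simp [bracket]⟩
  smul_mem' := by
    rintro c _ ⟨Z, rfl⟩
    refine ⟨c • Z, ?_⟩
    funext j
    simp [bracket, Finset.smul_sum, smul_sub]

/-- `B(F_X)`: the trivial deformations `L_Z X + f X` of the foliation `F_X`. -/
def trivialFolDefs (X : VF K n) : Submodule K (VF K n) where
  carrier := {Y | ∃ (Z : VF K n) (f : Fun K n), Y = bracket Z X + f • X}
  add_mem' := by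
    rintro _ _ ⟨Z, f, rfl⟩ ⟨Z', f', rfl⟩
    obtain ⟨W, hW⟩ := (trivialDefs X).add_mem ⟨Z, rfl⟩ ⟨Z', rfl⟩
    exact ⟨W, f + f', by rw [add_smul, ← hW]; abel⟩
  zero_mem' := ⟨0, 0, by funext j; simp [bracket]⟩
  smul_mem' := by
    rintro c _ ⟨Z, f, rfl⟩
    obtain ⟨W, hW⟩ := (trivialDefs X).smul_mem c ⟨Z, rfl⟩
    exact ⟨W, c • f, by rw [smul_add, hW, smul_assoc]⟩

/-- The deformation cohomology `DH(X) = Z(X) / B(X)`. -/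
abbrev DH (X : VF K n) := infDefs X ⧸ (trivialDefs X).submoduleOf (infDefs X)

/-- The deformation cohomology `DH(F_X) = Z(X) / B(F_X)` of the foliation defined by `X`. -/
abbrev DHFol (X : VF K n) := infDefs X ⧸ (trivialFolDefs X).submoduleOf (infDefs X)

/-! ### Linear vector fields -/

/-- The linear vector field `∑ j, (∑ i, A j i xᵢ) ∂/∂xⱼ`. -/
def linearField (A : Matrix (Fin n) (Fin n) K) : VF K n :=
  fun j => ∑ i, A j i • (MvPowerSeries.X i : Fun K n)

/-- The space of linear vector fields. -/
def linearFields (K : Type*) [Field K] (n : ℕ) : Submodule K (VF K n) where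
  carrier := {Y | ∃ A : Matrix (Fin n) (Fin n) K, Y = linearField A}
  add_mem' := by
    rintro _ _ ⟨A, rfl⟩ ⟨B, rfl⟩
    refine ⟨A + B, ?_⟩
    funext j
    simp [linearField, add_smul, Finset.sum_add_distrib]
  zero_mem' := ⟨0, by funext j; simp [linearField]⟩
  smul_mem' := by
    rintro c _ ⟨A, rfl⟩
    refine ⟨c • A, ?_⟩
    funext j
    simp [linearField, Finset.smul_sum, smul_smul]

/-- The matrix of the linear part of a formal vector field: the Jacobian matrix at the origin. -/
def linearMatrix (X : VF K n) : Matrix (Fin n) (Fin n) K :=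
  Matrix.of fun j i => MvPowerSeries.coeff (Finsupp.single i 1) (X j)

/-- The linear part `X⁽¹⁾`, a linear vector field. -/
def linearPart (X : VF K n) : VF K n := linearField (linearMatrix X)

/-- `DH_lin(L)`: linear infinitesimal deformations of `L` modulo linear trivial deformations. -/
abbrev DHLin (L : VF K n) :=
  (infDefs L ⊓ linearFields K n : Submodule K (VF K n)) ⧸
    (trivialDefs L ⊓ linearFields K n).submoduleOf (infDefs L ⊓ linearFields K n)

/-- The eigenvalues of `A` in an algebraic closure of `K`, counted with algebraic multiplicity. -/
def eigenvalues (A : Matrix (Fin n) (Fin n) K) : Multiset (AlgebraicClosure K) :=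
  (A.charpoly.map (algebraMap K (AlgebraicClosure K))).roots

/-- `A` is non-resonant: with `λ₁, …, λₙ` its eigenvalues, there is no relation
`λⱼ = m₁ λ₁ + ⋯ + mₙ λₙ` with integers `mᵢ ≥ 0`, `m₁ + ⋯ + mₙ ≥ 2`. In other words, no eigenvalue
is a sum of two or more eigenvalues, repetitions allowed. -/
def NonResonant (A : Matrix (Fin n) (Fin n) K) : Prop :=
  ∀ μ ∈ eigenvalues A, ∀ s : Multiset (AlgebraicClosure K),
    (∀ ν ∈ s, ν ∈ eigenvalues A) → 2 ≤ Multiset.card s → μ ≠ s.sum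

/-! ### The adjoint orbit and its dimension -/

/-- `S` is a smooth embedded `d`-dimensional submanifold of `E`: near each of its points it is the
zero set of a smooth map to `𝕜ᶜ`, `c + d = dim E`, that is a submersion at that point. (For
`𝕜 = ℂ` smooth means holomorphic and `d` is the complex dimension.) -/
def IsSubmanifoldOfDim (𝕜 : Type*) [RCLike 𝕜] {E : Type*} [NormedAddCommGroup E]
    [NormedSpace 𝕜 E] (S : Set E) (d : ℕ) : Prop :=
  ∀ x ∈ S, ∃ (c : ℕ) (F : E → Fin c → 𝕜), c + d = Module.finrank 𝕜 E ∧
    ContDiffAt 𝕜 (⊤ : ℕ∞) F x ∧ Function.Surjective (fderiv 𝕜 F x) ∧ ∀ᶠ y in 𝓝 x, y ∈ S ↔ F y = 0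

/-- The orbit `{g A g⁻¹}` of `A` under the adjoint action of `GLₙ(K)` on `𝔤𝔩ₙ(K)`. -/
def adjointOrbit (A : Matrix (Fin n) (Fin n) K) : Set (Matrix (Fin n) (Fin n) K) :=
  Set.range fun g : GL (Fin n) K =>
    (g : Matrix (Fin n) (Fin n) K) * A * ((g⁻¹ : GL (Fin n) K) : Matrix (Fin n) (Fin n) K)

section
attribute [local instance] Matrix.linftyOpNormedAddCommGroup Matrix.linftyOpNormedSpace

/-- The adjoint orbit of `A` is a `d`-dimensional submanifold of `𝔤𝔩ₙ(𝕜)` (all norms on this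
finite-dimensional space being equivalent, the choice of one is immaterial). -/
def AdjointOrbitHasDim {𝕜 : Type*} [RCLike 𝕜] (A : Matrix (Fin n) (Fin n) 𝕜) (d : ℕ) : Prop :=
  IsSubmanifoldOfDim 𝕜 (adjointOrbit A) d

end

end

end DefCoh

/-! For a vector field the conditions defining infinitesimal deformations are void
(`infDefs_eq_top`). They reduce to the identities `α ∧ i_Y Ω = α(Y) Ω`, `d(i_Y Ω) = div(Y) Ω` and `α
∧ Ω = 0`, together with the antisymmetry of `Ω(X, …, Y)` in `X` and `Y`. Hence `DH(X)` is the
cokernel of `Z ↦ [Z, X]` on all formal vector fields.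

Since `X(0) = 0`, this operator does not lower the order, and its leading part is the bracket with
`X⁽¹⁾` (`comp_bracket`). A homogeneous field of degree `k` killed by the latter produces an
eigenvalue of `A` that is a sum of `k` eigenvalues of `A` (`exists_common_eigenvalue`,
`eigenvalue_linearDer`). Without resonances this forces `k = 1`; in degree zero the contradiction is
that an eigenvalue `0` is itself a resonance. Homogeneous fields of a given degree form a
finite-dimensional space, so the homological equation is solvable in every degree except one, and
solving it degree by degree leaves only a linear remainder (`exists_comp_sub_bracket_eq_zero`). Thus
`DH(X)` is the space of matrices modulo commutators with `A`. For the foliation one divides also by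
`f X`, which equals `f(0) X⁽¹⁾` up to trivial deformations. This costs exactly one dimension: an
invertible `A` is never of the form `BA - AB`, by taking the trace after multiplication by `A⁻¹`.

The orbit of `A` is cut out near each point by an explicit submersion built from a generalized
inverse of the commutator operator (`exists_submersion_conj_orbit`), so its dimension is the rank of
that operator, and `n² - d` is the dimension of the centralizer of `A`. The latter is at least `n`
by the structure theorem for modules over `K[X]`, and equal to `n` when a cyclic vector exists, as
for distinct eigenvalues. -/

namespace DefCoh

open scoped Topology

/-! ### Exterior calculus of `(n-1)`-forms: every vector field is an infinitesimal deformation. -/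

noncomputable section Forms

variable {K : Type*} [Field K] {n : ℕ}

/-- The vectors `(α(v₀), v₀), …, (α(vₙ), vₙ)` of `Rⁿ⁺¹` lie on a hyperplane; expand their
determinant along the first column. -/
lemma sum_neg_one_pow_mul_det_eq_zero {R : Type*} [CommRing R] (α : Fin n → R)
    (v : Fin (n + 1) → Fin n → R) :
    ∑ k : Fin (n + 1), (-1) ^ (k : ℕ) * (α ⬝ᵥ v k) *
      Matrix.detRowAlternating (fun i => v (k.succAbove i)) = 0 := by
  let M : Matrix (Fin (n + 1)) (Fin (n + 1)) R :=
    Matrix.of fun k => (Fin.cons (α ⬝ᵥ v k) (v k) : Fin (n + 1) → R)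
  -- The entry `1` of this kernel vector lets the adjugate argument give `det M = 0` over any
  -- commutative ring.
  let w : Fin (n + 1) → R := Fin.cons 1 (-α)
  have hw : M.mulVec w = 0 := by
    funext k
    simp only [M, w, Matrix.mulVec, dotProduct, Fin.sum_univ_succ, Matrix.of_apply,
      Fin.cons_zero, Fin.cons_succ, Pi.neg_apply, Pi.zero_apply]
    rw [mul_one, ← Finset.sum_add_distrib]
    exact Finset.sum_eq_zero fun i _ => by ring
  have hdet : M.det = 0 := by
    have h := congrArg (M.adjugate.mulVec) hw
    rw [Matrix.mulVec_mulVec, Matrix.adjugate_mul, Matrix.mulVec_zero, Matrix.smul_mulVec,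
      Matrix.one_mulVec] at h
    simpa [w] using congrFun h 0
  rw [Matrix.det_succ_column_zero] at hdet
  rw [← hdet]
  refine Finset.sum_congr rfl fun k _ => ?_
  congr 1

lemma dotProduct_single {R : Type*} [CommRing R] (α : Fin n → R) (i : Fin n) :
    α ⬝ᵥ (Pi.single i 1) = α i := by
  simp

/-- The component `Ω(∂_{I 0}, …, ∂_{I (n-1)})` of the volume form. -/
def volComp (K : Type*) [Field K] (n : ℕ) : FormComp K n n :=
  fun I => Matrix.detRowAlternating (fun i => (Pi.single (I i) 1 : VF K n))

lemma volContract_apply {p : ℕ} (X : VF K (p + 1)) (I : Fin p → Fin (p + 1)) :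
    volContract rfl X I = Matrix.detRowAlternating
      (Fin.cons X (fun l => Pi.single (I l) 1) : Fin (p + 1) → VF K (p + 1)) :=
  rfl

/-- The determinant identity for `Y, ∂_{I 0}, …, ∂_{I p}`: the term that omits `Y` is `α(Y) Ω`, and
the other terms add up to minus the wedge product. -/
lemma wedge_volContract {p : ℕ} (α : Fin (p + 1) → Fun K (p + 1)) (Y : VF K (p + 1)) :
    wedge α (volContract rfl Y) = (α ⬝ᵥ Y) • volComp K (p + 1) := by
  funext I
  have h := sum_neg_one_pow_mul_det_eq_zero α
    (Fin.cons Y fun k => Pi.single (I k) 1 : Fin (p + 1 + 1) → VF K (p + 1))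
  rw [Fin.sum_univ_succ] at h
  simp only [Fin.val_zero, pow_zero, one_mul, Fin.cons_zero, Fin.zero_succAbove, Fin.cons_succ,
    Fin.val_succ, dotProduct_single] at h
  have h' := eq_neg_of_add_eq_zero_left h
  rw [← Finset.sum_neg_distrib] at h'
  simp only [Pi.smul_apply, volComp, smul_eq_mul]
  refine Eq.trans ?_ h'.symm
  unfold wedge
  refine Finset.sum_congr rfl fun k _ => ?_
  rw [pow_succ, mul_neg_one, neg_mul, neg_mul, neg_neg, volContract_apply]
  congr 2
  funext i
  refine Fin.cases ?_ (fun l => ?_) i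
  · simp
  · simp [Fin.succ_succAbove_succ]

lemma wedge_smul_volComp (α : Fin n → Fun K n) (c : Fun K n) :
    wedge α (c • volComp K n) = 0 := by
  funext I
  have h := sum_neg_one_pow_mul_det_eq_zero α
    (fun k => Pi.single (I k) 1 : Fin (n + 1) → VF K n)
  simp only [dotProduct_single] at h
  have := congrArg (c * ·) h
  simp only [mul_zero, Finset.mul_sum] at this
  refine Eq.trans ?_ this
  refine Finset.sum_congr rfl fun k _ => ?_
  simp only [Pi.smul_apply, smul_eq_mul, volComp]
  ring

lemma map_cons_eq_sum {R : Type*} [CommRing R] {p : ℕ}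
    (f : (Fin n → R) [⋀^Fin (p + 1)]→ₗ[R] R) (Y : Fin n → R) (v : Fin p → Fin n → R) :
    f (Fin.cons Y v) = ∑ j, Y j * f (Fin.cons (Pi.single j 1) v) := by
  have key : ∀ Z : Fin n → R, (Fin.cons Z v : Fin (p + 1) → Fin n → R) =
      Function.update (Fin.cons 0 v : Fin (p + 1) → Fin n → R) 0 Z := fun Z =>
    (Fin.update_cons_zero _ _ _).symm
  rw [key]
  conv_lhs => rw [pi_eq_sum_univ' Y]
  rw [AlternatingMap.map_update_sum]
  refine Finset.sum_congr rfl fun j _ => ?_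
  rw [AlternatingMap.map_update_smul, ← key, smul_eq_mul]

lemma pd_volContract_single {p : ℕ} (i j : Fin (p + 1)) (J : Fin p → Fin (p + 1)) :
    pd i (volContract rfl (Pi.single j 1 : VF K (p + 1)) J) = 0 := by
  have : volContract rfl (Pi.single j 1 : VF K (p + 1)) J =
      MvPowerSeries.C (Matrix.det (Matrix.of fun r : Fin (p + 1) =>
        (Fin.cons (Pi.single j 1) (fun l => Pi.single (J l) 1) :
          Fin (p + 1) → Fin (p + 1) → K) r)) := by
    rw [RingHom.map_det]
    unfold volContract
    congr 1
    refine Matrix.ext fun r c => ?_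
    refine Fin.cases ?_ (fun l => ?_) r
    · by_cases h : c = j <;> simp [h]
    · by_cases h : c = J l <;> simp [h]
  rw [this]
  exact MvPowerSeries.pderiv_C

/-- Write `i_Y Ω = ∑ Y_j i_{∂_j} Ω`. The forms `i_{∂_j} Ω` have constant components, so the
differential is `∑ dY_j ∧ i_{∂_j} Ω`, the divergence times `Ω`. -/
lemma extDer_volContract {p : ℕ} (Y : VF K (p + 1)) :
    extDer (volContract rfl Y) = (∑ j, pd j (Y j)) • volComp K (p + 1) := by
  have h : extDer (volContract rfl Y) =
      ∑ j, wedge (fun i => pd i (Y j)) (volContract rfl (Pi.single j 1 : VF K (p + 1))) := by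
    funext I
    simp only [extDer, wedge, Finset.sum_apply]
    rw [Finset.sum_comm]
    refine Finset.sum_congr rfl fun k _ => ?_
    rw [volContract_apply, map_cons_eq_sum]
    simp only [← volContract_apply, pd, map_sum, Finset.mul_sum]
    refine Finset.sum_congr rfl fun j _ => ?_
    have := pd_volContract_single (K := K) (I k) j (fun l => I (k.succAbove l))
    rw [pd] at this
    rw [Derivation.leibniz, this]
    simp only [smul_eq_mul]
    ring
  rw [h, Finset.sum_smul]
  refine Finset.sum_congr rfl fun j _ => ?_
  rw [wedge_volContract, dotProduct_single]

lemma sum_volContract_snoc {r : ℕ} (X Y : VF K (r + 2)) (J : Fin r → Fin (r + 2)) :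
    ∑ k, volContract rfl X (Fin.snoc J k : Fin (r + 1) → Fin (r + 2)) * Y k =
      Matrix.detRowAlternating (Fin.cons X (Fin.snoc (fun l => Pi.single (J l) 1) Y :
        Fin (r + 1) → VF K (r + 2)) : Fin (r + 2) → VF K (r + 2)) := by
  have key : ∀ Z : VF K (r + 2), (Fin.cons X (Fin.snoc (fun l => Pi.single (J l) 1) Z :
        Fin (r + 1) → VF K (r + 2)) : Fin (r + 2) → VF K (r + 2)) =
      Function.update (Fin.cons X (Fin.snoc (fun l => Pi.single (J l) 1) 0 :
        Fin (r + 1) → VF K (r + 2)) : Fin (r + 2) → VF K (r + 2)) (Fin.last r).succ Z := by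
    intro Z
    rw [← Fin.cons_update, Fin.update_snoc_last]
  rw [key]
  conv_rhs => rw [pi_eq_sum_univ' Y]
  rw [AlternatingMap.map_update_sum]
  refine Finset.sum_congr rfl fun k _ => ?_
  rw [AlternatingMap.map_update_smul, ← key, smul_eq_mul, mul_comm, volContract_apply]
  congr 2
  funext i
  refine Fin.cases rfl (fun l => ?_) i
  refine Fin.lastCases ?_ (fun m => ?_) l
  · simp only [Fin.cons_succ, Fin.snoc_last]
  · simp only [Fin.cons_succ, Fin.snoc_castSucc]

/-- Both pairings are combinations, with the same coefficients `A J`, of values of `Ω` whose first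
and last arguments `X` and `Y` are exchanged. -/
lemma contract_volContract_dotProduct {r : ℕ} (A : (Fin r → Fin (r + 2)) → Fun K (r + 2))
    (X Y : VF K (r + 2)) :
    contract A (volContract rfl X) ⬝ᵥ Y + contract A (volContract rfl Y) ⬝ᵥ X = 0 := by
  have h : ∀ X Y : VF K (r + 2), contract A (volContract rfl X) ⬝ᵥ Y = ∑ J, A J *
      Matrix.detRowAlternating (Fin.cons X (Fin.snoc (fun l => Pi.single (J l) 1) Y :
        Fin (r + 1) → VF K (r + 2)) : Fin (r + 2) → VF K (r + 2)) := by
    intro X Y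
    simp only [← sum_volContract_snoc, dotProduct, contract, Finset.sum_mul, Finset.mul_sum]
    rw [Finset.sum_comm]
    simp only [mul_assoc]
  rw [h, h, ← Finset.sum_add_distrib]
  refine Finset.sum_eq_zero fun J _ => ?_
  have hswap : (Fin.cons Y (Fin.snoc (fun l => Pi.single (J l) 1) X :
        Fin (r + 1) → VF K (r + 2)) : Fin (r + 2) → VF K (r + 2)) =
      (Fin.cons X (Fin.snoc (fun l => Pi.single (J l) 1) Y :
        Fin (r + 1) → VF K (r + 2)) : Fin (r + 2) → VF K (r + 2)) ∘
        Equiv.swap 0 (Fin.last r).succ := by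
    funext i
    refine Fin.cases ?_ (fun l => ?_) i
    · simp
    · refine Fin.lastCases ?_ (fun m => ?_) l
      · simp
      · rw [Function.comp_apply, Equiv.swap_apply_of_ne_of_ne (Fin.succ_ne_zero _)
          (fun h => (Fin.castSucc_lt_last m).ne (Fin.succ_injective _ h))]
        simp
  rw [hswap, AlternatingMap.map_swap _ _ (Fin.succ_ne_zero _).symm, mul_neg, add_neg_cancel]

/-- For one-dimensional foliations the conditions defining infinitesimal deformations are void. -/
theorem infDefs_eq_top (X : VF K n) : infDefs X = ⊤ := by
  refine eq_top_iff.2 fun Y _ p h => ?_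
  cases p with
  | zero => trivial
  | succ r =>
    subst h
    intro A
    constructor
    -- In the first condition the two terms cancel; in the second each one vanishes separately,
    -- being a form of degree `n + 1`.
    · rw [wedge_volContract, wedge_volContract, ← add_smul, contract_volContract_dotProduct,
        zero_smul]
    · rw [extDer_volContract, extDer_volContract, wedge_smul_volComp, wedge_smul_volComp,
        add_zero]

end Forms
end DefCoh
namespace DefCoh

open scoped Topology

/-! ### The conjugation orbit as a submanifold. -/

noncomputable section Orbit

/-- A linear section of `f` over its range, extended arbitrarily to `W`. -/
lemma exists_generalized_inverse {k V W : Type*} [Field k] [AddCommGroup V] [Module k V]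
    [AddCommGroup W] [Module k W] (f : V →ₗ[k] W) : ∃ J : W →ₗ[k] V, ∀ x, f (J (f x)) = f x := by
  obtain ⟨s, hs⟩ := f.rangeRestrict.exists_rightInverse_of_surjective f.range_rangeRestrict
  obtain ⟨J, hJ⟩ := LinearMap.exists_extend s
  refine ⟨J, fun x => ?_⟩
  have h₁ : J (f x) = s (f.rangeRestrict x) := congrArg (fun l => l (f.rangeRestrict x)) hJ
  have h₂ := congrArg (fun l => ((l (f.rangeRestrict x) : f.range) : W)) hs
  rw [h₁]
  exact h₂

section Algebra

variable (k : Type*) {R : Type*} [Field k] [Ring R] [Algebra k R]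

/-- The operator `g ↦ g a - b g`, whose kernel is the space of intertwiners of `a` and `b`. -/
def intertwining (a b : R) : R →ₗ[k] R := LinearMap.mulRight k a - LinearMap.mulLeft k b

variable {k}

@[simp] lemma intertwining_apply (a b g : R) : intertwining k a b g = g * a - b * g := rfl

/-- The map `g ↦ w g u⁻¹` carries one space of intertwiners onto the other. Two independent units
are allowed because the orbit argument compares the centralizer of `a` with the intertwiners of `a`
and a conjugate of `a`. -/
lemma finrank_ker_intertwining_conj (a : R) (u w : Rˣ) :
    Module.finrank k (intertwining k (u * a * ↑u⁻¹) (w * a * ↑w⁻¹)).ker =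
      Module.finrank k (intertwining k a a).ker := by
  let e : R ≃ₗ[k] R := LinearEquiv.ofLinearMap
    (LinearMap.mulLeft k (w : R) ∘ₗ LinearMap.mulRight k (↑u⁻¹ : R))
    (LinearMap.mulLeft k (↑w⁻¹ : R) ∘ₗ LinearMap.mulRight k (u : R))
    (by ext g; simp [← mul_assoc]) (by ext g; simp [← mul_assoc])
  have he : ∀ g, e g = w * (g * ↑u⁻¹) := fun g => rfl
  have h : (intertwining k a a).ker =
      (intertwining k (u * a * ↑u⁻¹) (w * a * ↑w⁻¹)).ker.comap e.toLinearMap := by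
    ext g
    have : intertwining k (u * a * ↑u⁻¹) (w * a * ↑w⁻¹) (e g) = e (intertwining k a a g) := by
      rw [he, he, intertwining_apply, intertwining_apply]
      simp only [mul_assoc, Units.inv_mul_cancel_left, mul_sub, sub_mul]
    rw [Submodule.mem_comap, LinearMap.mem_ker, LinearMap.mem_ker, LinearEquiv.coe_coe, this,
      LinearEquiv.map_eq_zero_iff]
  rw [h]
  exact (LinearEquiv.finrank_eq (e.ofSubmodule' _)).symm

end Algebra

variable {𝕜 R : Type*} [RCLike 𝕜] [NormedRing R] [NormedAlgebra 𝕜 R] [FiniteDimensional 𝕜 R]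

/-- The orbit of `a` under conjugation is cut out near `a` by a submersion. -/
lemma exists_submersion_conj_orbit (a : R) :
    ∃ (c : ℕ) (F : R → Fin c → 𝕜),
      c + Module.finrank 𝕜 (intertwining 𝕜 a a).range = Module.finrank 𝕜 R ∧
      ContDiffAt 𝕜 (⊤ : ℕ∞) F a ∧ Function.Surjective (fderiv 𝕜 F a) ∧
      ∀ᶠ b in 𝓝 a, b ∈ Set.range (fun u : Rˣ => (u : R) * a * ↑u⁻¹) ↔ F b = 0 := by
  have : CompleteSpace R := FiniteDimensional.complete 𝕜 R
  obtain ⟨J, hJ⟩ : ∃ J : R →L[𝕜] R,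
      ∀ x, intertwining 𝕜 a a (J (intertwining 𝕜 a a x)) = intertwining 𝕜 a a x := by
    obtain ⟨J, hJ⟩ := exists_generalized_inverse (intertwining 𝕜 a a)
    exact ⟨LinearMap.toContinuousLinearMap J, hJ⟩
  -- With `T_b g = g a - b g`, left multiplication by `a - b` is `T_b - T_a`. The choice gives `T_a
  -- N_b = T_a J T_b`, so `N_b` sends `ker T_b` into `ker T_a`, and `N_a = 1`.
  let N : R → (R →L[𝕜] R) := fun b => 1 + J ∘L (ContinuousLinearMap.mul 𝕜 R (a - b))
  have hN : ∀ b x, N b x = x + J (intertwining 𝕜 a b x - intertwining 𝕜 a a x) := by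
    intro b x
    simp only [N, add_apply, one_apply_eq_self,
      ContinuousLinearMap.comp_apply, ContinuousLinearMap.mul_apply', intertwining_apply]
    congr 2
    noncomm_ring
  have hNa : N a = 1 := by simp [N]
  have hNc : ContDiff 𝕜 (⊤ : ℕ∞) N := by fun_prop
  -- The candidate conjugator, to satisfy `g(b) a = b g(b)` exactly when `b` lies on the orbit near
  -- `a`.
  let g : R → R := fun b => Ring.inverse (N b) 1
  have hga : g a = 1 := by simp [g, hNa]
  have hgc : ContDiffAt 𝕜 (⊤ : ℕ∞) g a := by
    have h1 : ContDiffAt 𝕜 (⊤ : ℕ∞) (fun b => Ring.inverse (N b)) a := by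
      have h2 := contDiffAt_ringInverse 𝕜 (n := (⊤ : ℕ∞)) (1 : (R →L[𝕜] R)ˣ)
      have h3 : ContDiffAt 𝕜 (⊤ : ℕ∞) Ring.inverse (N a) := by rw [hNa]; exact h2
      exact h3.comp a hNc.contDiffAt
    exact h1.clm_apply contDiffAt_const
  have hgN : ∀ᶠ b in 𝓝 a, IsUnit (N b) := by
    refine hNc.continuous.continuousAt.eventually (p := IsUnit) ?_
    rw [hNa]
    exact Units.isOpen.mem_nhds isUnit_one
  have hgu : ∀ᶠ b in 𝓝 a, IsUnit (g b) := by
    refine hgc.continuousAt.eventually (p := IsUnit) ?_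
    rw [hga]
    exact Units.isOpen.mem_nhds isUnit_one
  obtain ⟨c, q, hc, hq, hqs⟩ : ∃ (c : ℕ) (q : R →L[𝕜] (Fin c → 𝕜)),
      c + Module.finrank 𝕜 (intertwining 𝕜 a a).range = Module.finrank 𝕜 R ∧
      (∀ x, q x = 0 ↔ ∃ y, intertwining 𝕜 a a y = x) ∧ Function.Surjective q := by
    let e := (Module.finBasis 𝕜 (R ⧸ (intertwining 𝕜 a a).range)).equivFun
    refine ⟨_, LinearMap.toContinuousLinearMap
      (e.toLinearMap ∘ₗ (intertwining 𝕜 a a).range.mkQ),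
      Submodule.finrank_quotient_add_finrank _, fun x => ?_,
      e.surjective.comp (Submodule.mkQ_surjective _)⟩
    change e (Submodule.Quotient.mk x) = 0 ↔ _
    rw [LinearEquiv.map_eq_zero_iff, Submodule.Quotient.mk_eq_zero, LinearMap.mem_range]
  -- The defect `T_b (g b)` is read only modulo the range of `T_a`; this yields the right number of
  -- equations.
  refine ⟨c, fun b => q (g b * a - b * g b), hc, ?_, ?_, ?_⟩
  · exact q.contDiff.contDiffAt.comp a
      ((hgc.mul contDiffAt_const).sub (contDiffAt_id.mul hgc))
  · have hg' : HasFDerivAt g (fderiv 𝕜 g a) a :=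
      (hgc.differentiableAt (by simp)).hasFDerivAt
    have h := q.hasFDerivAt.comp a
      ((hg'.mul' (hasFDerivAt_const a a)).sub ((hasFDerivAt_id (𝕜 := 𝕜) a).mul' hg'))
    intro y
    obtain ⟨x, rfl⟩ := hqs y
    -- The derivative at `a` is `-q`: the contribution of `dg` is a commutator with `a`, which `q`
    -- kills.
    refine ⟨-x, ?_⟩
    have h0 : q (fderiv 𝕜 g a x * a - a * fderiv 𝕜 g a x) = 0 :=
      (hq _).2 ⟨fderiv 𝕜 g a x, rfl⟩
    refine (congrArg (fun l => l (-x)) h.fderiv).trans ?_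
    simp only [hga, ContinuousLinearMap.comp_apply, sub_apply, add_apply, smul_apply,
      smul_zero, zero_add, id_eq, smul_eq_mul, MulOpposite.smul_eq_mul_unop, MulOpposite.unop_op,
      ContinuousLinearMap.id_apply, mul_one]
    rw [show fderiv 𝕜 g a (-x) * a - (a * fderiv 𝕜 g a (-x) + -x) =
      x - (fderiv 𝕜 g a x * a - a * fderiv 𝕜 g a x) by rw [map_neg]; noncomm_ring, map_sub, h0,
      sub_zero]
  · filter_upwards [hgN, hgu] with b hb hu
    have hgb : N b (g b) = 1 := by
      have := congrArg (fun l => l (1 : R)) (Ring.mul_inverse_cancel _ hb)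
      exact this
    constructor
    · rintro ⟨u, hub⟩
      have hmap : ∀ v ∈ (intertwining 𝕜 a b).ker,
          N b v ∈ (intertwining 𝕜 a a).ker := by
        intro v hv
        rw [LinearMap.mem_ker] at hv ⊢
        rw [hN, hv, zero_sub, map_neg, map_add, map_neg, hJ, add_neg_cancel]
      let T := (N b : R →ₗ[𝕜] R).restrict hmap
      have hT : Function.Injective T := by
        intro v w hvw
        have h1 : N b v = N b w := congrArg Subtype.val hvw
        have h2 := congrArg (fun x => Ring.inverse (N b) x) h1
        have h3 : ∀ x, Ring.inverse (N b) (N b x) = x := fun x =>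
          congrArg (fun l => l x) (Ring.inverse_mul_cancel _ hb)
        simp only [h3] at h2
        exact Subtype.ext h2
      -- On the orbit `ker T_b` and `ker T_a` have equal dimension, so the injective map `N_b`
      -- between them is onto and reaches `1`. Its preimage is `g(b)`, hence an intertwiner.
      have hdim := finrank_ker_intertwining_conj (k := 𝕜) a 1 u
      rw [show ((1 : Rˣ) : R) * a * ↑(1 : Rˣ)⁻¹ = a by simp,
        show (u : R) * a * ↑u⁻¹ = b from hub] at hdim
      obtain ⟨v, hv⟩ := (LinearMap.injective_iff_surjective_of_finrank_eq_finrank hdim).1 hT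
        ⟨1, by simp⟩
      have hv' : N b v = 1 := congrArg Subtype.val hv
      have hgv : g b = v := by
        have h3 : Ring.inverse (N b) (N b v) = v :=
          congrArg (fun l => l (v : R)) (Ring.inverse_mul_cancel _ hb)
        rw [hv'] at h3
        exact h3
      have := v.2
      rw [LinearMap.mem_ker, intertwining_apply] at this
      rw [hgv, this, map_zero]
    · intro h
      obtain ⟨y, hy⟩ := (hq _).1 h
      rw [hN] at hgb
      -- If `T_b (g b) = T_a y`, applying `T_a` to `N_b (g b) = 1` leaves `T_a y = T_a 1 = 0`; so
      -- `g(b)`, a unit near `a`, conjugates `a` to `b`.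
      have h1 := congrArg (intertwining 𝕜 a a) hgb
      have h2 : intertwining 𝕜 a b (g b) = intertwining 𝕜 a a y := hy.symm
      rw [map_add, map_sub, map_sub, h2, hJ, hJ, add_sub_cancel] at h1
      have h3 : intertwining 𝕜 a b (g b) = 0 := by
        rw [h2, h1]; simp
      rw [intertwining_apply, sub_eq_zero] at h3
      refine ⟨hu.unit, ?_⟩
      change g b * a * _ = b
      rw [h3, mul_assoc]
      have := hu.unit.mul_inv
      rw [hu.unit_spec] at this
      rw [this, mul_one]

theorem isSubmanifoldOfDim_conj_orbit (a : R) :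
    IsSubmanifoldOfDim 𝕜 (Set.range fun u : Rˣ => (u : R) * a * ↑u⁻¹)
      (Module.finrank 𝕜 (intertwining 𝕜 a a).range) := by
  rintro _ ⟨u, rfl⟩
  obtain ⟨c, F, hc, hF, hs, hz⟩ := exists_submersion_conj_orbit (𝕜 := 𝕜) ((u : R) * a * ↑u⁻¹)
  refine ⟨c, F, ?_, hF, hs, ?_⟩
  · have h₁ := (intertwining 𝕜 a a).finrank_range_add_finrank_ker
    have h₂ := (intertwining 𝕜 ((u : R) * a * ↑u⁻¹)
      ((u : R) * a * ↑u⁻¹)).finrank_range_add_finrank_ker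
    rw [finrank_ker_intertwining_conj] at h₂
    rw [← hc]
    omega
  · convert hz using 3
    rename_i b
    constructor
    · rintro ⟨w, rfl⟩
      exact ⟨w * u⁻¹, by simp [mul_assoc]⟩
    · rintro ⟨w, rfl⟩
      exact ⟨w * u, by simp [mul_assoc]⟩

section
attribute [local instance] Matrix.linftyOpNormedAddCommGroup Matrix.linftyOpNormedSpace
  Matrix.linftyOpNormedRing Matrix.linftyOpNormedAlgebra

theorem adjointOrbitHasDim {𝕜 : Type*} [RCLike 𝕜] {n : ℕ} (A : Matrix (Fin n) (Fin n) 𝕜) :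
    AdjointOrbitHasDim A (Module.finrank 𝕜 (intertwining 𝕜 A A).range) :=
  isSubmanifoldOfDim_conj_orbit (𝕜 := 𝕜) A

end

end Orbit
end DefCoh
namespace DefCoh

open scoped Topology

/-! ### The dimension of the centralizer of a matrix. -/

noncomputable section Centralizer

open Polynomial

/-- A module that is isomorphic to a commutative algebra acts faithfully on itself. -/
lemma exists_injective_end_of_equiv {R M P : Type*} [CommRing R] [AddCommGroup M] [Module R M]
    [CommRing P] [Algebra R P] (e : M ≃ₗ[R] P) :
    ∃ μ : M →ₗ[R] (M →ₗ[R] M), Function.Injective μ := by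
  refine ⟨e.symm.conj.toLinearMap ∘ₗ LinearMap.mul R P ∘ₗ e.toLinearMap, ?_⟩
  intro a b h
  apply e.injective
  simpa using congrArg (fun l => e (l (e.symm 1))) h

lemma isTorsion_aeval' {K V : Type*} [Field K] [AddCommGroup V] [Module K V]
    [FiniteDimensional K V] (f : Module.End K V) :
    Module.IsTorsion K[X] (Module.AEval' f) := by
  intro x
  refine ⟨⟨minpoly K f, mem_nonZeroDivisors_of_ne_zero
    (minpoly.ne_zero (Algebra.IsIntegral.isIntegral f))⟩, ?_⟩
  change minpoly K f • x = 0
  obtain ⟨v, rfl⟩ := (Module.AEval'.of f).surjective x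
  have := Module.AEval.of_aeval_smul (R := K) (M := V) (a := f) (minpoly K f) v
  rw [minpoly.aeval, zero_smul, map_zero] at this
  exact this.symm

/-- As a torsion `K[X]`-module, `V` is isomorphic to a product of quotient rings of `K[X]`.
Multiplication in that commutative ring embeds `V` into its `K[X]`-endomorphisms, which are the maps
commuting with `f`. -/
lemma exists_injective_centralizer {K V : Type*} [Field K] [AddCommGroup V] [Module K V]
    [FiniteDimensional K V] (f : Module.End K V) :
    ∃ μ : V →ₗ[K] Module.End K V, Function.Injective μ ∧ ∀ v, μ v * f = f * μ v := by
  obtain ⟨ι, _, p, -, e, ⟨E⟩⟩ := Module.equiv_directSum_of_isTorsion (isTorsion_aeval' f)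
  obtain ⟨μ, hμ⟩ := exists_injective_end_of_equiv (P := ∀ i, K[X] ⧸ Ideal.span {p i ^ e i})
    (E ≪≫ₗ DirectSum.linearEquivFunOnFintype K[X] ι (fun i => K[X] ⧸ Ideal.span {p i ^ e i}))
  let o := Module.AEval'.of f
  have ho : ∀ v, o (f v) = (X : K[X]) • o v := fun v => (Module.AEval'.X_smul_of f v).symm
  refine ⟨{ toFun := fun v => o.symm.toLinearMap ∘ₗ (μ (o v)).restrictScalars K ∘ₗ o.toLinearMap
            map_add' := fun v w => ?_
            map_smul' := fun c v => ?_ }, fun v w h => ?_, fun v => ?_⟩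
  · ext x
    simp
  · ext x
    apply o.injective
    simp
  · apply o.injective
    apply hμ
    ext x
    have := congrArg (fun l => o (l (o.symm x))) h
    simpa using this
  · ext x
    apply o.injective
    simp [ho]

theorem le_finrank_ker_intertwining {K : Type*} [Field K] {n : ℕ}
    (A : Matrix (Fin n) (Fin n) K) : n ≤ Module.finrank K (intertwining K A A).ker := by
  obtain ⟨μ, hμ, hc⟩ := exists_injective_centralizer (Matrix.toLinAlgEquiv' A)
  let g : (Fin n → K) →ₗ[K] (intertwining K A A).ker :=
    (Matrix.toLinAlgEquiv'.symm.toLinearMap ∘ₗ μ).codRestrict _ (fun v => by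
      rw [LinearMap.mem_ker, intertwining_apply, sub_eq_zero]
      apply Matrix.toLinAlgEquiv'.injective
      rw [map_mul, map_mul]
      simpa using hc v)
  have hg : Function.Injective g := by
    intro v w h
    exact hμ (Matrix.toLinAlgEquiv'.symm.injective (congrArg Subtype.val h))
  simpa using LinearMap.finrank_le_finrank_of_injective hg

lemma eigenvalues_card {K : Type*} [Field K] {n : ℕ} (A : Matrix (Fin n) (Fin n) K) :
    Multiset.card (eigenvalues A) = n := by
  rw [eigenvalues, splits_iff_card_roots.1 (IsAlgClosed.splits _), natDegree_map,
    Matrix.charpoly_natDegree_eq_dim, Fintype.card_fin]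

lemma isRoot_of_mem_eigenvalues {K : Type*} [Field K] {n : ℕ} {A : Matrix (Fin n) (Fin n) K}
    {μ : AlgebraicClosure K} (h : μ ∈ eigenvalues A) :
    (A.map (algebraMap K (AlgebraicClosure K))).charpoly.IsRoot μ := by
  rw [Matrix.charpoly_map]
  exact isRoot_of_mem_roots h

/-- A left eigenvector over the closure, restricted to `Kⁿ`. Its kernel is then a `K`-subspace of
`Kⁿ`, so a cyclic vector can be sought over `K` itself. -/
lemma exists_left_eigenvector {K : Type*} [Field K] {n : ℕ} {A : Matrix (Fin n) (Fin n) K}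
    {μ : AlgebraicClosure K} (h : μ ∈ eigenvalues A) :
    ∃ φ : (Fin n → K) →ₗ[K] AlgebraicClosure K, φ ≠ 0 ∧ ∀ v, φ (A.mulVec v) = μ * φ v := by
  have h' := isRoot_of_mem_eigenvalues h
  rw [IsRoot, Matrix.eval_charpoly, ← Matrix.exists_vecMul_eq_zero_iff] at h'
  obtain ⟨l, hl, hl'⟩ := h'
  rw [Matrix.vecMul_sub, sub_eq_zero, Matrix.scalar_apply] at hl'
  refine ⟨∑ j, (LinearMap.mulLeft K (l j) ∘ₗ Algebra.linearMap K _) ∘ₗ LinearMap.proj j, ?_, ?_⟩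
  · intro h0
    apply hl
    funext j
    simpa [Pi.single_apply] using congrArg (fun φ => φ (Pi.single j 1)) h0
  · intro v
    simp only [Matrix.mulVec, dotProduct, LinearMap.sum_apply, LinearMap.comp_apply,
      LinearMap.proj_apply, Algebra.linearMap_apply, LinearMap.mulLeft_apply, map_sum, map_mul,
      Finset.mul_sum]
    rw [Finset.sum_comm]
    refine Finset.sum_congr rfl fun i _ => ?_
    have := congrFun hl' i
    rw [Matrix.vecMul_diagonal] at this
    simp only [Matrix.vecMul, dotProduct, Matrix.map_apply] at this
    rw [← mul_assoc, mul_comm μ, this, Finset.sum_mul]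
    simp only [mul_assoc]

lemma map_aeval_mulVec {K F : Type*} [Field K] [Field F] [Algebra K F] {n : ℕ}
    {A : Matrix (Fin n) (Fin n) K} {μ : F} {φ : (Fin n → K) →ₗ[K] F}
    (h : ∀ v, φ (A.mulVec v) = μ * φ v) (p : K[X]) (v : Fin n → K) :
    φ ((aeval A p).mulVec v) = aeval μ p * φ v := by
  induction p using Polynomial.induction_on with
  | C a => simp [Algebra.algebraMap_eq_smul_one, Matrix.smul_mulVec]
  | add p q hp hq => simp [Matrix.add_mulVec, hp, hq, add_mul]
  | monomial m a ih =>
    rw [pow_succ', mul_left_comm, map_mul, aeval_X, map_mul (aeval μ) X, aeval_X,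
      ← Matrix.mulVec_mulVec, h,
      ih, mul_assoc]

/-- A matrix with pairwise distinct eigenvalues has a cyclic vector. -/
lemma exists_cyclic_vector {K : Type*} [Field K] [Infinite K] {n : ℕ}
    {A : Matrix (Fin n) (Fin n) K} (h : (eigenvalues A).Nodup) :
    ∃ v : Fin n → K, ∀ w, ∃ p : K[X], (aeval A p).mulVec v = w := by
  classical
  choose φ hφ hφA using fun μ : {μ // μ ∈ (eigenvalues A).toFinset} =>
    exists_left_eigenvector (Multiset.mem_toFinset.1 μ.2)
  -- Over an infinite field finitely many proper subspaces do not cover `Kⁿ`.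
  obtain ⟨v, hv⟩ := Submodule.exists_forall_notMem_of_forall_ne_top (fun μ => (φ μ).ker)
    (fun μ => by rw [Ne, LinearMap.ker_eq_top]; exact hφ μ)
  refine ⟨v, ?_⟩
  let T : degreeLT K n →ₗ[K] (Fin n → K) :=
    { toFun := fun p => (aeval A (p : K[X])).mulVec v
      map_add' := fun p q => by simp [Matrix.add_mulVec]
      map_smul' := fun c p => by simp [Matrix.smul_mulVec] }
  -- If `p(A) v = 0`, then `p(μ) φ_μ(v) = 0` for each eigenvalue, so a polynomial of degree less
  -- than `n` has `n` distinct roots.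
  have hT : Function.Injective T := by
    rw [← LinearMap.ker_eq_bot, LinearMap.ker_eq_bot']
    rintro ⟨p, hp⟩ h0
    have h0' : (aeval A p).mulVec v = 0 := h0
    have hroot : ∀ μ ∈ (eigenvalues A).toFinset,
        (p.map (algebraMap K (AlgebraicClosure K))).eval μ = 0 := by
      intro μ hμ
      have := map_aeval_mulVec (hφA ⟨μ, hμ⟩) p v
      rw [h0', map_zero, eq_comm, mul_eq_zero] at this
      rw [eval_map_algebraMap]
      exact this.resolve_right (hv ⟨μ, hμ⟩)
    have hcard : (eigenvalues A).toFinset.card = n := by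
      rw [Multiset.toFinset_card_of_nodup h, eigenvalues_card]
    have := eq_zero_of_degree_lt_of_eval_finset_eq_zero _
      (by rw [hcard, degree_map]; exact mem_degreeLT.1 hp) hroot
    rw [Polynomial.map_eq_zero] at this
    exact Subtype.ext this
  have hdim : Module.finrank K (degreeLT K n) = Module.finrank K (Fin n → K) :=
    (degreeLTEquiv K n).finrank_eq
  have : FiniteDimensional K (degreeLT K n) :=
    Module.Finite.equiv (degreeLTEquiv K n).symm
  intro w
  obtain ⟨p, hp⟩ := (LinearMap.injective_iff_surjective_of_finrank_eq_finrank hdim).1 hT w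
  exact ⟨p, hp⟩

/-- A matrix commuting with `A` commutes with every `p(A)`, so its value at a cyclic vector
determines it; this gives the upper bound. -/
theorem finrank_ker_intertwining_of_nodup {K : Type*} [Field K] [Infinite K] {n : ℕ}
    {A : Matrix (Fin n) (Fin n) K} (h : (eigenvalues A).Nodup) :
    Module.finrank K (intertwining K A A).ker = n := by
  refine le_antisymm ?_ (le_finrank_ker_intertwining A)
  obtain ⟨v, hv⟩ := exists_cyclic_vector h
  let T : (intertwining K A A).ker →ₗ[K] (Fin n → K) :=
    { toFun := fun B => (B : Matrix (Fin n) (Fin n) K).mulVec v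
      map_add' := fun p q => by simp [Matrix.add_mulVec]
      map_smul' := fun c p => by simp [Matrix.smul_mulVec] }
  have hT : Function.Injective T := by
    rw [← LinearMap.ker_eq_bot, LinearMap.ker_eq_bot']
    rintro ⟨B, hB⟩ h0
    have h0' : B.mulVec v = 0 := h0
    have hB' : Commute B A := by
      rwa [LinearMap.mem_ker, intertwining_apply, sub_eq_zero] at hB
    refine Subtype.ext (Matrix.mulVec_injective ?_)
    funext w
    obtain ⟨p, rfl⟩ := hv w
    have hp : B * aeval A p = aeval A p * B := by
      rw [aeval_eq_sum_range]
      exact Commute.sum_right _ _ _ fun i _ => (hB'.pow_right i).smul_right _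
    simp [Matrix.mulVec_mulVec, hp]
    simp [← Matrix.mulVec_mulVec, h0']
  simpa using LinearMap.finrank_le_finrank_of_injective hT

end Centralizer
end DefCoh
namespace DefCoh

open scoped Topology

/-! ### Homogeneous functions and the spectrum of a linear vector field. -/

noncomputable section Graded

open MvPowerSeries

variable {K : Type*} [Field K] {n : ℕ}

/-- The formal functions all of whose monomials have degree at least `k`. -/
def orderGE (K : Type*) [Field K] (n k : ℕ) : Submodule K (Fun K n) where
  carrier := {f | ∀ d : Fin n →₀ ℕ, d.degree < k → coeff d f = 0}
  add_mem' := fun {f g} hf hg d hd => by rw [map_add, hf d hd, hg d hd, add_zero]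
  zero_mem' := fun d _ => map_zero _
  smul_mem' := fun c f hf d hd => by rw [map_smul, hf d hd, smul_zero]

/-- The homogeneous polynomials of degree `k`. -/
def homog (K : Type*) [Field K] (n k : ℕ) : Submodule K (Fun K n) where
  carrier := {f | ∀ d : Fin n →₀ ℕ, d.degree ≠ k → coeff d f = 0}
  add_mem' := fun {f g} hf hg d hd => by rw [map_add, hf d hd, hg d hd, add_zero]
  zero_mem' := fun d _ => map_zero _
  smul_mem' := fun c f hf d hd => by rw [map_smul, hf d hd, smul_zero]

lemma homog_le_orderGE (k : ℕ) : homog K n k ≤ orderGE K n k :=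
  fun _ hf d hd => hf d hd.ne

lemma orderGE_anti {k l : ℕ} (h : k ≤ l) : orderGE K n l ≤ orderGE K n k :=
  fun _ hf d hd => hf d (hd.trans_le h)

lemma mul_mem_orderGE {a b : ℕ} {f g : Fun K n} (hf : f ∈ orderGE K n a)
    (hg : g ∈ orderGE K n b) : f * g ∈ orderGE K n (a + b) := by
  classical
  intro d hd
  rw [coeff_mul]
  refine Finset.sum_eq_zero fun x hx => ?_
  rw [Finset.HasAntidiagonal.mem_antidiagonal] at hx
  rw [← hx, map_add] at hd
  rcases lt_or_ge x.1.degree a with h | h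
  · rw [hf _ h, zero_mul]
  · rw [hg _ (by omega), mul_zero]

lemma mul_mem_homog {a b : ℕ} {f g : Fun K n} (hf : f ∈ homog K n a)
    (hg : g ∈ homog K n b) : f * g ∈ homog K n (a + b) := by
  classical
  intro d hd
  rw [coeff_mul]
  refine Finset.sum_eq_zero fun x hx => ?_
  rw [Finset.HasAntidiagonal.mem_antidiagonal] at hx
  rw [← hx, map_add] at hd
  by_cases h : x.1.degree = a
  · rw [hg _ (by omega), mul_zero]
  · rw [hf _ h, zero_mul]

lemma degree_add_single (d : Fin n →₀ ℕ) (i : Fin n) :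
    (d + Finsupp.single i 1).degree = d.degree + 1 := by
  simp

lemma pd_mem_orderGE {k : ℕ} {f : Fun K n} (hf : f ∈ orderGE K n (k + 1)) (i : Fin n) :
    pd i f ∈ orderGE K n k := by
  intro d hd
  rw [pd, coeff_pderiv, hf _ (by rw [degree_add_single]; omega), zero_mul]

lemma pd_mem_homog {k : ℕ} {f : Fun K n} (hf : f ∈ homog K n (k + 1)) (i : Fin n) :
    pd i f ∈ homog K n k := by
  intro d hd
  rw [pd, coeff_pderiv, hf _ (by rw [degree_add_single]; omega), zero_mul]

lemma pd_eq_zero_of_mem_homog_zero {f : Fun K n} (hf : f ∈ homog K n 0) (i : Fin n) :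
    pd i f = 0 := by
  ext d
  rw [pd, coeff_pderiv, hf _ (by rw [degree_add_single]; omega), zero_mul, coeff_zero]

lemma pd_sum {ι : Type*} (s : Finset ι) (i : Fin n) (f : ι → Fun K n) :
    pd i (∑ a ∈ s, f a) = ∑ a ∈ s, pd i (f a) :=
  map_sum _ _ _

lemma pd_mul (i : Fin n) (f g : Fun K n) : pd i (f * g) = f * pd i g + g * pd i f :=
  Derivation.leibniz _ _ _

lemma pd_smul (i : Fin n) (c : K) (f : Fun K n) : pd i (c • f) = c • pd i f :=
  Derivation.map_smul _ _ _

lemma pd_comm (i j : Fin n) (f : Fun K n) : pd i (pd j f) = pd j (pd i f) := by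
  ext d
  simp only [pd, coeff_pderiv, Finsupp.add_apply, Finsupp.single_apply]
  by_cases h : i = j
  · subst h; rfl
  · rw [add_right_comm d]
    simp [h, Ne.symm h]
    ring

lemma exists_pd_ne_zero [CharZero K] {k : ℕ} {f : Fun K n} (hf : f ∈ homog K n (k + 1))
    (h0 : f ≠ 0) : ∃ i, pd i f ≠ 0 := by
  by_contra! h
  apply h0
  ext d
  rw [coeff_zero]
  by_cases hd : d.degree = k + 1
  · obtain ⟨i, hi⟩ : ∃ i, d i ≠ 0 := by
      by_contra! hz
      have : d = 0 := Finsupp.ext hz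
      simp [this] at hd
    have hdi : d - Finsupp.single i 1 + Finsupp.single i 1 = d :=
      tsub_add_cancel_of_le (by simpa [Nat.one_le_iff_ne_zero] using hi)
    have := congrArg (coeff (d - Finsupp.single i 1)) (h i)
    rw [pd, coeff_pderiv, hdi, coeff_zero] at this
    refine (mul_eq_zero.1 this).resolve_right ?_
    exact Nat.cast_add_one_ne_zero _
  · exact hf d hd

lemma linearField_mem_homog (A : Matrix (Fin n) (Fin n) K) (j : Fin n) :
    linearField A j ∈ homog K n 1 := by
  classical
  refine Submodule.sum_mem _ fun i _ => Submodule.smul_mem _ _ fun d hd => ?_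
  rw [coeff_X, if_neg]
  rintro rfl
  simp at hd

lemma coeff_single_linearField (A : Matrix (Fin n) (Fin n) K) (i j : Fin n) :
    coeff (Finsupp.single i 1) (linearField A j) = A j i := by
  classical
  simp only [linearField, map_sum, map_smul, coeff_X, smul_eq_mul]
  simp [Finsupp.single_left_inj]

lemma pd_linearField (A : Matrix (Fin n) (Fin n) K) (i j : Fin n) :
    pd i (linearField A j) = C (A j i) := by
  classical
  simp only [linearField, pd, map_sum, Derivation.map_smul, pderiv_X, Pi.single_apply]
  simp [smul_eq_C_mul]

/-- The derivative along the linear vector field of `A`. -/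
def linearDer (A : Matrix (Fin n) (Fin n) K) : Fun K n →ₗ[K] Fun K n :=
  ∑ i, LinearMap.mulLeft K (linearField A i) ∘ₗ (pderiv K i).toLinearMap

lemma linearDer_apply (A : Matrix (Fin n) (Fin n) K) (f : Fun K n) :
    linearDer A f = ∑ i, linearField A i * pd i f := by
  simp [linearDer]

lemma linearDer_mem_homog (A : Matrix (Fin n) (Fin n) K) {k : ℕ} {f : Fun K n}
    (hf : f ∈ homog K n k) : linearDer A f ∈ homog K n k := by
  rw [linearDer_apply]
  refine Submodule.sum_mem _ fun i _ => ?_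
  cases k with
  | zero => rw [pd_eq_zero_of_mem_homog_zero hf, mul_zero]; exact Submodule.zero_mem _
  | succ k =>
    rw [add_comm]
    exact mul_mem_homog (linearField_mem_homog A i) (pd_mem_homog hf i)

lemma linearDer_pd (A : Matrix (Fin n) (Fin n) K) (j : Fin n) (f : Fun K n) :
    linearDer A (pd j f) = pd j (linearDer A f) - ∑ i, A i j • pd i f := by
  rw [linearDer_apply, linearDer_apply, pd_sum, ← Finset.sum_sub_distrib]
  refine Finset.sum_congr rfl fun i _ => ?_
  rw [pd_mul, pd_linearField, pd_comm, smul_eq_C_mul]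
  ring

lemma bracket_linearField (Z : VF K n) (A : Matrix (Fin n) (Fin n) K) (j : Fin n) :
    bracket Z (linearField A) j = ∑ i, A j i • Z i - linearDer A (Z j) := by
  rw [bracket, linearDer_apply, Finset.sum_sub_distrib]
  congr 1
  refine Finset.sum_congr rfl fun i _ => ?_
  rw [pd_linearField, smul_eq_C_mul, mul_comm]

/-! ### Eigenvalues of the derivative along a linear vector field -/

/-- Apply the factors `T - a` one at a time: the last nonzero vector before the product vanishes is
an eigenvector. -/
lemma exists_eigenvector_of_aeval_prod {F P : Type*} [Field F] [AddCommGroup P] [Module F P]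
    (T : Module.End F P) {W : Submodule F P} (hW : ∀ w ∈ W, T w ∈ W) (s : Multiset F) :
    ∀ w ∈ W, w ≠ 0 →
      Polynomial.aeval T (s.map fun a => Polynomial.X - Polynomial.C a).prod w = 0 →
      ∃ a ∈ s, ∃ g ∈ W, g ≠ 0 ∧ T g = a • g := by
  induction s using Multiset.induction_on with
  | empty => intro w _ h0 h; simp at h; exact absurd h h0
  | cons a s ih =>
    intro w hw h0 h
    by_cases hz : T w - a • w = 0
    · exact ⟨a, Multiset.mem_cons_self _ _, w, hw, h0, sub_eq_zero.1 hz⟩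
    · rw [Multiset.map_cons, Multiset.prod_cons, mul_comm, map_mul] at h
      obtain ⟨b, hb, hg⟩ := ih (T w - a • w) (W.sub_mem (hW w hw) (W.smul_mem _ hw)) hz
        (by simpa [Algebra.algebraMap_eq_smul_one] using h)
      exact ⟨b, Multiset.mem_cons_of_mem hb, hg⟩

/-- On the span of the `φ j` the operator acts through `M`, so by Cayley–Hamilton the characteristic
polynomial of `M` in `T` kills every `φ j`; split it into linear factors. The `φ j` need not be
independent. -/
lemma exists_common_eigenvalue {F P : Type*} [Field F] [IsAlgClosed F] [AddCommGroup P]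
    [Module F P] (T : Module.End F P) {W : Submodule F P} (hW : ∀ w ∈ W, T w ∈ W)
    (M : Matrix (Fin n) (Fin n) F) (φ : Fin n → P) (hφW : ∀ j, φ j ∈ W)
    (hT : ∀ j, T (φ j) = ∑ i, M i j • φ i) (hφ : ∃ j, φ j ≠ 0) :
    ∃ a, M.charpoly.IsRoot a ∧ ∃ g ∈ W, g ≠ 0 ∧ T g = a • g := by
  have key : ∀ p : Polynomial F, ∀ j,
      Polynomial.aeval T p (φ j) = ∑ i, Polynomial.aeval M p i j • φ i := by
    intro p
    induction p using Polynomial.induction_on with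
    | C a =>
      intro j
      simp [Algebra.algebraMap_eq_smul_one, Matrix.one_apply]
    | add p q hp hq =>
      intro j
      simp [hp, hq, add_smul, Finset.sum_add_distrib]
    | monomial m a ih =>
      intro j
      rw [pow_succ, ← mul_assoc, map_mul, Polynomial.aeval_X, Module.End.mul_apply, hT, map_sum,
        map_mul (Polynomial.aeval M), Polynomial.aeval_X]
      simp only [map_smul, ih, Matrix.mul_apply, Finset.sum_smul, Finset.smul_sum, smul_smul]
      rw [Finset.sum_comm]
      simp only [mul_comm]
  obtain ⟨j, hj⟩ := hφ
  have h0 : Polynomial.aeval T M.charpoly (φ j) = 0 := by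
    rw [key, Matrix.aeval_self_charpoly]
    simp
  rw [(IsAlgClosed.splits M.charpoly).eq_prod_roots_of_monic M.charpoly_monic] at h0
  obtain ⟨a, ha, hg⟩ := exists_eigenvector_of_aeval_prod T hW _ (φ j) (hφW j) hj h0
  exact ⟨a, Polynomial.isRoot_of_mem_roots ha, hg⟩

/-- Induction on the degree by differentiation. If `L f = a f`, then `(a - L) ∂_j f = ∑ A_{ij} ∂_i
f`, so `a - L` has an eigenvector of degree one less whose eigenvalue `b` belongs to `A`. There `L`
has eigenvalue `a - b`. No triangular form of `A` is needed. -/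
lemma eigenvalue_linearDer {F : Type*} [Field F] [IsAlgClosed F] [CharZero F]
    (A : Matrix (Fin n) (Fin n) F) (k : ℕ) : ∀ (f : Fun F n) (a : F), f ∈ homog F n k → f ≠ 0 →
      linearDer A f = a • f →
      ∃ s : Multiset F, (∀ b ∈ s, A.charpoly.IsRoot b) ∧ Multiset.card s = k ∧ a = s.sum := by
  induction k with
  | zero =>
    intro f a hf h0 h
    refine ⟨0, by simp, rfl, ?_⟩
    rw [linearDer_apply, Finset.sum_eq_zero
      (fun i _ => by rw [pd_eq_zero_of_mem_homog_zero hf, mul_zero]), eq_comm,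
      smul_eq_zero] at h
    simpa using h.resolve_right h0
  | succ k ih =>
    intro f a hf h0 h
    obtain ⟨b, hb, g, hg, hg0, hgb⟩ := exists_common_eigenvalue
      (T := a • (1 : Module.End F (Fun F n)) - linearDer A) (W := homog F n k)
      (fun w hw => Submodule.sub_mem _ (Submodule.smul_mem _ _ hw) (linearDer_mem_homog A hw))
      A (fun j => pd j f) (pd_mem_homog hf)
      (fun j => by
        rw [LinearMap.sub_apply, LinearMap.smul_apply, Module.End.one_apply, linearDer_pd, h,
          pd_smul, sub_sub_cancel])
      (exists_pd_ne_zero hf h0)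
    rw [LinearMap.sub_apply, LinearMap.smul_apply, Module.End.one_apply] at hgb
    obtain ⟨s, hs, hsk, hsum⟩ := ih g (a - b) hg hg0 (by rw [sub_smul, ← hgb, sub_sub_cancel])
    refine ⟨b ::ₘ s, ?_, by simp [hsk], by simp [← hsum]⟩
    intro c hc
    rcases Multiset.mem_cons.1 hc with rfl | hc
    · exact hb
    · exact hs c hc

lemma map_linearDer {F : Type*} [Field F] (σ : K →+* F) (A : Matrix (Fin n) (Fin n) K)
    (f : Fun K n) : MvPowerSeries.map σ (linearDer A f) =
      linearDer (A.map σ) (MvPowerSeries.map σ f) := by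
  rw [linearDer_apply, linearDer_apply, map_sum]
  refine Finset.sum_congr rfl fun i _ => ?_
  rw [map_mul]
  congr 1
  · simp [linearField, smul_eq_C_mul]
  · ext d
    simp [pd, coeff_pderiv]

lemma isRoot_charpoly_map_iff (A : Matrix (Fin n) (Fin n) K) (a : AlgebraicClosure K) :
    (A.map (algebraMap K (AlgebraicClosure K))).charpoly.IsRoot a ↔ a ∈ eigenvalues A := by
  rw [eigenvalues, Polynomial.mem_roots', Matrix.charpoly_map]
  exact ⟨fun h => ⟨((Matrix.charpoly_monic A).map _).ne_zero, h⟩, fun h => h.2⟩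

/-- Without resonances, the bracket with the linear vector field of `A` is injective on the
homogeneous vector fields of degree `k ≠ 1`. -/
lemma eq_zero_of_bracket_linearField_eq_zero [CharZero K] {A : Matrix (Fin n) (Fin n) K}
    (hA : NonResonant A) {k : ℕ} (hk : k ≠ 1) {Z : VF K n} (hZ : ∀ j, Z j ∈ homog K n k)
    (h : bracket Z (linearField A) = 0) : Z = 0 := by
  let σ := algebraMap K (AlgebraicClosure K)
  have : CharZero (AlgebraicClosure K) := charZero_of_injective_algebraMap σ.injective
  by_contra hne
  have hmap : ∀ f : Fun K n, MvPowerSeries.map σ f = 0 → f = 0 := by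
    intro f hf
    ext d
    have := congrArg (coeff d) hf
    rw [coeff_map, coeff_zero] at this
    rw [coeff_zero]
    exact (map_eq_zero σ).1 this
  -- The vanishing of the bracket says `L Z_j = ∑ A_{ji} Z_i`: over the closure, the components of
  -- `Z` force a common eigenvalue of `A` and of `L` in degree `k`.
  obtain ⟨a, ha, g, hg, hg0, hga⟩ := exists_common_eigenvalue (linearDer (A.map σ))
    (W := homog (AlgebraicClosure K) n k) (fun w hw => linearDer_mem_homog _ hw)
    (A.map σ).transpose (fun j => MvPowerSeries.map σ (Z j))
    (fun j d hd => by rw [coeff_map, hZ j d hd, map_zero])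
    (fun j => by
      have hj := congrFun h j
      rw [bracket_linearField, Pi.zero_apply, sub_eq_zero] at hj
      rw [← map_linearDer, ← hj, map_sum]
      simp [smul_eq_C_mul])
    (by
      by_contra! hz
      exact hne (funext fun j => hmap _ (hz j)))
  rw [Matrix.charpoly_transpose, isRoot_charpoly_map_iff] at ha
  obtain ⟨s, hs, hsk, hsum⟩ := eigenvalue_linearDer _ k g a hg hg0 hga
  simp only [σ, isRoot_charpoly_map_iff] at hs
  rcases Nat.lt_or_gt_of_ne hk with hk | hk
  -- In degree zero the sum is empty, so `0` is an eigenvalue and `0 = 0 + 0` is a resonance.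
  · have h0 : s = 0 := by
      rw [← Multiset.card_eq_zero]
      omega
    rw [h0, Multiset.sum_zero] at hsum
    subst hsum
    exact hA 0 ha {0, 0} (by simpa using ha) (by simp) (by simp)
  · exact hA a ha s hs (by omega) hsum

end Graded
end DefCoh
namespace DefCoh

open scoped Topology

/-! ### Solving `Y = [Z, X]` degree by degree. -/

noncomputable section Solve

open MvPowerSeries

variable {K : Type*} [Field K] {n : ℕ}

/-- The homogeneous component of degree `k` of a formal vector field. -/
def comp (k : ℕ) : VF K n →ₗ[K] VF K n :=
  LinearMap.pi fun j => homogeneousComponent k ∘ₗ LinearMap.proj j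

lemma coeff_comp (k : ℕ) (Z : VF K n) (j : Fin n) (d : Fin n →₀ ℕ) :
    coeff d (comp k Z j) = if d.degree = k then coeff d (Z j) else 0 :=
  coeff_homogeneousComponent k d (Z j)

/-- The homogeneous vector fields of degree `k`. -/
def homogVF (K : Type*) [Field K] (n k : ℕ) : Submodule K (VF K n) :=
  Submodule.pi Set.univ fun _ => homog K n k

/-- The formal vector fields all of whose monomials have degree at least `k`. -/
def orderGEVF (K : Type*) [Field K] (n k : ℕ) : Submodule K (VF K n) :=
  Submodule.pi Set.univ fun _ => orderGE K n k

lemma mem_homogVF {k : ℕ} {Z : VF K n} : Z ∈ homogVF K n k ↔ ∀ j, Z j ∈ homog K n k := by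
  simp [homogVF, Submodule.mem_pi]

lemma mem_orderGEVF {k : ℕ} {Z : VF K n} : Z ∈ orderGEVF K n k ↔ ∀ j, Z j ∈ orderGE K n k := by
  simp [orderGEVF, Submodule.mem_pi]

lemma mem_orderGEVF_zero (Z : VF K n) : Z ∈ orderGEVF K n 0 :=
  mem_orderGEVF.2 fun _ _ hd => absurd hd (Nat.not_lt_zero _)

lemma comp_mem_homogVF (k : ℕ) (Z : VF K n) : comp k Z ∈ homogVF K n k :=
  mem_homogVF.2 fun j d hd => by rw [coeff_comp, if_neg hd]

lemma comp_eq_self {k : ℕ} {Z : VF K n} (h : Z ∈ homogVF K n k) : comp k Z = Z := by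
  funext j
  ext d
  rw [coeff_comp]
  split_ifs with hd
  · rfl
  · exact (mem_homogVF.1 h j d hd).symm

lemma comp_eq_zero_of_mem_homogVF {k l : ℕ} (hkl : k ≠ l) {Z : VF K n}
    (h : Z ∈ homogVF K n l) : comp k Z = 0 := by
  funext j
  ext d
  rw [coeff_comp]
  split_ifs with hd
  · exact mem_homogVF.1 h j d (hd ▸ hkl)
  · simp

lemma comp_eq_zero_of_mem_orderGEVF {k l : ℕ} (hkl : k < l) {Z : VF K n}
    (h : Z ∈ orderGEVF K n l) : comp k Z = 0 := by
  funext j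
  ext d
  rw [coeff_comp]
  split_ifs with hd
  · exact mem_orderGEVF.1 h j d (hd ▸ hkl)
  · simp

lemma eq_zero_of_comp_eq_zero {Z : VF K n} (h : ∀ k, comp k Z = 0) : Z = 0 := by
  funext j
  ext d
  have := congrArg (fun W : VF K n => coeff d (W j)) (h d.degree)
  simpa [coeff_comp] using this

lemma mem_homogVF_of_comp_eq_zero {k : ℕ} {Z : VF K n} (h : ∀ l, l ≠ k → comp l Z = 0) :
    Z ∈ homogVF K n k := by
  refine mem_homogVF.2 fun j d hd => ?_
  have := congrArg (fun W : VF K n => coeff d (W j)) (h d.degree hd)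
  simpa [coeff_comp] using this

lemma sub_comp_mem_orderGEVF {k : ℕ} {Z : VF K n} (h : Z ∈ orderGEVF K n k) :
    Z - comp k Z ∈ orderGEVF K n (k + 1) := by
  refine mem_orderGEVF.2 fun j d hd => ?_
  rw [Pi.sub_apply, map_sub, coeff_comp]
  split_ifs with hk
  · rw [sub_self]
  · rw [sub_zero, mem_orderGEVF.1 h j d (by omega)]

lemma homogVF_le_orderGEVF (k : ℕ) : homogVF K n k ≤ orderGEVF K n k :=
  fun _ h => mem_orderGEVF.2 fun j => homog_le_orderGE k (mem_homogVF.1 h j)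

lemma mem_orderGEVF_succ {k : ℕ} {Z : VF K n} (h : Z ∈ orderGEVF K n k) (hk : comp k Z = 0) :
    Z ∈ orderGEVF K n (k + 1) := by
  simpa [hk] using sub_comp_mem_orderGEVF h

/-! ### Linear vector fields -/

lemma linearField_mem_homogVF (A : Matrix (Fin n) (Fin n) K) : linearField A ∈ homogVF K n 1 :=
  mem_homogVF.2 (linearField_mem_homog A)

lemma linearField_injective : Function.Injective (linearField : Matrix (Fin n) (Fin n) K → _) := by
  intro A B h
  ext j i
  rw [← coeff_single_linearField A i j, h, coeff_single_linearField]

lemma exists_single_of_degree_eq_one {d : Fin n →₀ ℕ} (h : d.degree = 1) :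
    ∃ i, d = Finsupp.single i 1 := by
  obtain ⟨i, hi⟩ : ∃ i, d i ≠ 0 := by
    by_contra! hz
    have : d = 0 := Finsupp.ext hz
    simp [this] at h
  have hdi : d - Finsupp.single i 1 + Finsupp.single i 1 = d :=
    tsub_add_cancel_of_le (by simpa [Nat.one_le_iff_ne_zero] using hi)
  have h0 : (d - Finsupp.single i 1).degree = 0 := by
    have := degree_add_single (d - Finsupp.single i 1) i
    rw [hdi] at this
    omega
  rw [Finsupp.degree_eq_zero_iff] at h0
  exact ⟨i, by rw [← hdi, h0, zero_add]⟩

lemma comp_one (X : VF K n) : comp 1 X = linearPart X := by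
  funext j
  ext d
  rw [coeff_comp]
  split_ifs with hd
  · obtain ⟨i, rfl⟩ := exists_single_of_degree_eq_one hd
    rw [linearPart, coeff_single_linearField]
    rfl
  · exact (linearField_mem_homog _ j d hd).symm

lemma linearMatrix_linearField (A : Matrix (Fin n) (Fin n) K) :
    linearMatrix (linearField A) = A := by
  ext j i
  exact coeff_single_linearField A i j

lemma linearPart_linearField (A : Matrix (Fin n) (Fin n) K) :
    linearPart (linearField A) = linearField A := by
  rw [linearPart, linearMatrix_linearField]

lemma eq_linearField_of_mem_homogVF_one {Z : VF K n} (h : Z ∈ homogVF K n 1) :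
    Z = linearField (linearMatrix Z) := by
  conv_lhs => rw [← comp_eq_self h, comp_one]
  rfl

/-! ### The bracket and the grading -/

lemma bracket_add_left (Z W X : VF K n) : bracket (Z + W) X = bracket Z X + bracket W X := by
  funext j
  simp only [bracket, Pi.add_apply, pd, map_add, ← Finset.sum_add_distrib]
  exact Finset.sum_congr rfl fun i _ => by ring

lemma bracket_smul_left (c : K) (Z X : VF K n) : bracket (c • Z) X = c • bracket Z X := by
  funext j
  simp [bracket, Finset.smul_sum, smul_sub]

lemma bracket_add_right (Z X Y : VF K n) : bracket Z (X + Y) = bracket Z X + bracket Z Y := by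
  funext j
  simp only [bracket, Pi.add_apply, pd, map_add, ← Finset.sum_add_distrib]
  exact Finset.sum_congr rfl fun i _ => by ring

lemma bracket_zero_left (X : VF K n) : bracket 0 X = 0 := by
  funext j
  simp [bracket]

/-- The bracket with a fixed vector field, as a linear map. -/
def bracketRight (X : VF K n) : VF K n →ₗ[K] VF K n where
  toFun Z := bracket Z X
  map_add' Z W := bracket_add_left Z W X
  map_smul' c Z := bracket_smul_left c Z X

lemma bracket_sub_left (Z W X : VF K n) : bracket (Z - W) X = bracket Z X - bracket W X :=
  map_sub (bracketRight X) Z W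

lemma mul_pd_mem_orderGE {a b c : ℕ} {f g : Fun K n} (hf : f ∈ orderGE K n a)
    (hg : g ∈ orderGE K n b) (h : c + 1 ≤ a + b) (i : Fin n) : f * pd i g ∈ orderGE K n c := by
  cases b with
  | zero =>
    exact orderGE_anti (by omega) (mul_mem_orderGE hf
      (b := 0) fun _ hd => absurd hd (Nat.not_lt_zero _))
  | succ b => exact orderGE_anti (by omega) (mul_mem_orderGE hf (pd_mem_orderGE hg i))

lemma bracket_mem_orderGEVF {a b c : ℕ} {Z X : VF K n} (hZ : Z ∈ orderGEVF K n a)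
    (hX : X ∈ orderGEVF K n b) (h : c + 1 ≤ a + b) : bracket Z X ∈ orderGEVF K n c := by
  rw [mem_orderGEVF] at *
  exact fun j => Submodule.sum_mem _ fun i _ => Submodule.sub_mem _
    (mul_pd_mem_orderGE (hZ i) (hX j) h i) (mul_pd_mem_orderGE (hX i) (hZ j) (by omega) i)

lemma bracket_linearField_mem_homogVF {k : ℕ} {Z : VF K n} (hZ : Z ∈ homogVF K n k)
    (A : Matrix (Fin n) (Fin n) K) : bracket Z (linearField A) ∈ homogVF K n k := by
  rw [mem_homogVF] at *
  intro j
  rw [bracket_linearField]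
  exact Submodule.sub_mem _ (Submodule.sum_mem _ fun i _ => Submodule.smul_mem _ _ (hZ i))
    (linearDer_mem_homog A (hZ j))

lemma mem_orderGEVF_one {X : VF K n} (hX : ∀ j, constantCoeff (X j) = 0) :
    X ∈ orderGEVF K n 1 := by
  refine mem_orderGEVF.2 fun j d hd => ?_
  have h0 : d.degree = 0 := by omega
  rw [Finsupp.degree_eq_zero_iff] at h0
  subst h0
  exact hX j

/-- The leading part of `[Z, X]` is the bracket of the leading part of `Z` with the linear part
of `X`. -/
lemma comp_bracket {X : VF K n} (hX : X ∈ orderGEVF K n 1) {k : ℕ} {Z : VF K n}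
    (hZ : Z ∈ orderGEVF K n k) : comp k (bracket Z X) = bracket (comp k Z) (linearPart X) := by
  have hX' : X - linearPart X ∈ orderGEVF K n 2 := by
    rw [← comp_one]
    exact sub_comp_mem_orderGEVF hX
  have h : bracket Z X = bracket (comp k Z) (linearPart X) +
      (bracket (Z - comp k Z) X + bracket (comp k Z) (X - linearPart X)) := by
    have h₁ := bracket_add_left (comp k Z) (Z - comp k Z) X
    have h₂ := bracket_add_right (comp k Z) (linearPart X) (X - linearPart X)
    rw [add_sub_cancel] at h₁ h₂
    rw [h₁, h₂]
    abel
  have h' : bracket (Z - comp k Z) X + bracket (comp k Z) (X - linearPart X) ∈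
      orderGEVF K n (k + 1) :=
    Submodule.add_mem _ (bracket_mem_orderGEVF (sub_comp_mem_orderGEVF hZ) hX le_rfl)
      (bracket_mem_orderGEVF (homogVF_le_orderGEVF k (comp_mem_homogVF k Z)) hX' le_rfl)
  rw [h, map_add, comp_eq_zero_of_mem_orderGEVF (Nat.lt_succ_self k) h', add_zero]
  exact comp_eq_self (bracket_linearField_mem_homogVF (comp_mem_homogVF k Z) _)

/-- Needed to pass from injectivity to surjectivity in the homological equation. -/
instance finiteDimensional_homogVF (k : ℕ) : FiniteDimensional K (homogVF K n k) := by
  have : Finite {d : Fin n →₀ ℕ // d.degree = k} := (Finsupp.finite_of_degree_eq k).to_subtype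
  let T : homogVF K n k →ₗ[K] (Fin n → {d : Fin n →₀ ℕ // d.degree = k} → K) :=
    { toFun := fun Z j d => coeff d.1 ((Z : VF K n) j)
      map_add' := fun Z W => by ext; simp
      map_smul' := fun c Z => by ext; simp }
  refine FiniteDimensional.of_injective T fun Z W h => Subtype.ext ?_
  funext j
  ext d
  by_cases hd : d.degree = k
  · exact congrFun (congrFun h j) ⟨d, hd⟩
  · rw [mem_homogVF.1 Z.2 j d hd, mem_homogVF.1 W.2 j d hd]

/-- Without resonances, the homological equation is solvable in degrees other than one. -/
lemma exists_bracket_linearField_eq [CharZero K] {A : Matrix (Fin n) (Fin n) K}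
    (hA : NonResonant A) {k : ℕ} (hk : k ≠ 1) {Y : VF K n} (hY : Y ∈ homogVF K n k) :
    ∃ Z ∈ homogVF K n k, bracket Z (linearField A) = Y := by
  let T : homogVF K n k →ₗ[K] homogVF K n k :=
    (bracketRight (linearField A)).restrict fun Z hZ => bracket_linearField_mem_homogVF hZ A
  have hT : Function.Injective T := by
    rw [← LinearMap.ker_eq_bot, LinearMap.ker_eq_bot']
    intro Z hZ
    exact Subtype.ext (eq_zero_of_bracket_linearField_eq_zero hA hk (mem_homogVF.1 Z.2)
      (congrArg Subtype.val hZ))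
  obtain ⟨Z, hZ⟩ := LinearMap.surjective_of_injective hT ⟨Y, hY⟩
  exact ⟨Z, Z.2, congrArg Subtype.val hZ⟩

lemma linearField_sub (A B : Matrix (Fin n) (Fin n) K) :
    linearField (A - B) = linearField A - linearField B := by
  funext j
  simp [linearField, sub_smul, Finset.sum_sub_distrib]

lemma sum_smul_linearField (A B : Matrix (Fin n) (Fin n) K) (j : Fin n) :
    ∑ i, A j i • linearField B i = linearField (A * B) j := by
  simp only [linearField, Matrix.mul_apply, Finset.smul_sum, Finset.sum_smul, smul_smul]
  exact Finset.sum_comm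

lemma bracket_linearField_linearField (B A : Matrix (Fin n) (Fin n) K) :
    bracket (linearField B) (linearField A) = linearField (A * B - B * A) := by
  funext j
  rw [bracket_linearField, linearField_sub, Pi.sub_apply, sum_smul_linearField,
    ← sum_smul_linearField B A, linearDer_apply]
  congr 1
  refine Finset.sum_congr rfl fun i _ => ?_
  rw [pd_linearField, smul_eq_C_mul, mul_comm]

variable [CharZero K] {X : VF K n}

/-- `Y = [Z, X]` is solvable up to a linear vector field, with prescribed linear part of `Z`. -/
lemma exists_comp_sub_bracket_eq_zero (hX : X ∈ orderGEVF K n 1)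
    (hres : NonResonant (linearMatrix X)) (Y : VF K n) (B : Matrix (Fin n) (Fin n) K) :
    ∃ Z : VF K n, comp 1 Z = linearField B ∧ ∀ k, k ≠ 1 → comp k (Y - bracket Z X) = 0 := by
  -- One correction step: `H` removes the degree `k` part of the error left by `W`, except in degree
  -- one, where it is prescribed.
  have step : ∀ (k : ℕ) (W : VF K n), ∃ H ∈ homogVF K n k, (k = 1 → H = linearField B) ∧
      (k ≠ 1 → bracket H (linearPart X) = comp k (Y - bracket W X)) := by
    intro k W
    by_cases hk : k = 1
    · subst hk
      exact ⟨linearField B, linearField_mem_homogVF B, fun _ => rfl, fun h => absurd rfl h⟩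
    · obtain ⟨H, hH, hHY⟩ := exists_bracket_linearField_eq hres hk
        (comp_mem_homogVF k (Y - bracket W X))
      exact ⟨H, hH, fun h => absurd h hk, fun _ => hHY⟩
  choose H hH hH1 hHk using step
  let W : ℕ → VF K n := fun k => Nat.rec 0 (fun k w => w + H k w) k
  have hW : ∀ k, W (k + 1) = W k + H k (W k) := fun k => rfl
  have hstab : ∀ (d : Fin n →₀ ℕ) (j : Fin n) (m : ℕ),
      coeff d (W (d.degree + 1 + m) j) = coeff d (W (d.degree + 1) j) := by
    intro d j m
    induction m with
    | zero => rfl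
    | succ m ih =>
      rw [← add_assoc, hW, Pi.add_apply, map_add, ih,
        mem_homogVF.1 (hH _ _) j d (by omega), add_zero]
  have hzero : ∀ (k : ℕ) (d : Fin n →₀ ℕ) (j : Fin n), k ≤ d.degree → coeff d (W k j) = 0 := by
    intro k d j hk
    induction k with
    | zero => exact map_zero _
    | succ k ih =>
      rw [hW, Pi.add_apply, map_add, ih (by omega), mem_homogVF.1 (hH _ _) j d (by omega),
        add_zero]
  -- The formal limit: `W k` collects the corrections of degree less than `k`, so a coefficient of
  -- degree `m` is final from stage `m + 1` on.
  let Z : VF K n := fun j => (fun d => coeff d (W (d.degree + 1) j) : (Fin n →₀ ℕ) → K)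
  have hZ : ∀ d j, coeff d (Z j) = coeff d (W (d.degree + 1) j) := fun d j => rfl
  have hZW : ∀ k, Z - W k ∈ orderGEVF K n k := by
    intro k
    refine mem_orderGEVF.2 fun j d hd => ?_
    obtain ⟨m, rfl⟩ := Nat.exists_eq_add_of_lt hd
    rw [Pi.sub_apply, map_sub, hZ, add_right_comm, hstab, sub_self]
  refine ⟨Z, ?_, fun k hk => ?_⟩
  · rw [← hH1 1 (W 1) rfl]
    funext j
    ext d
    rw [coeff_comp]
    split_ifs with hd
    · rw [hZ, hd, hW, Pi.add_apply, map_add, hzero 1 d j hd.ge, zero_add]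
    · exact (mem_homogVF.1 (hH 1 (W 1)) j d hd).symm
  -- The corrections after stage `k` have order at least `k + 1`, and so have their brackets with
  -- `X`; the degree `k` part of the error is settled by `H k` alone.
  · have h₁ : Y - bracket Z X =
        Y - bracket (W k) X - bracket (H k (W k)) X - bracket (Z - W (k + 1)) X := by
      rw [bracket_sub_left, hW, bracket_add_left]
      abel
    rw [h₁, map_sub, map_sub, comp_bracket hX (homogVF_le_orderGEVF k (hH k (W k))),
      comp_eq_self (hH k (W k)), hHk k (W k) hk, sub_self, zero_sub, neg_eq_zero]
    exact comp_eq_zero_of_mem_orderGEVF (Nat.lt_succ_self k)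
      (bracket_mem_orderGEVF (hZW (k + 1)) hX le_rfl)

/-- If `[Z, X]` vanishes at the origin then so does `Z`. -/
lemma mem_orderGEVF_one_of_bracket (hX : X ∈ orderGEVF K n 1)
    (hres : NonResonant (linearMatrix X)) {Z : VF K n} (h : comp 0 (bracket Z X) = 0) :
    Z ∈ orderGEVF K n 1 := by
  rw [comp_bracket hX (mem_orderGEVF_zero Z)] at h
  exact mem_orderGEVF_succ (mem_orderGEVF_zero Z)
    (eq_zero_of_bracket_linearField_eq_zero hres zero_ne_one
      (mem_homogVF.1 (comp_mem_homogVF 0 Z)) h)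

/-- A vector field vanishing at the origin is a trivial deformation of `X` if and only if its
linear part is the bracket of a linear vector field with the linear part of `X`. -/
lemma mem_trivialDefs_iff (hX : X ∈ orderGEVF K n 1) (hres : NonResonant (linearMatrix X))
    {Y : VF K n} (hY : comp 0 Y = 0) :
    Y ∈ trivialDefs X ↔
      ∃ B : Matrix (Fin n) (Fin n) K, linearPart Y = bracket (linearField B) (linearPart X) := by
  constructor
  · rintro ⟨Z, rfl⟩
    refine ⟨linearMatrix Z, ?_⟩
    rw [← comp_one, comp_bracket hX (mem_orderGEVF_one_of_bracket hX hres hY), comp_one]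
    rfl
  · rintro ⟨B, hB⟩
    obtain ⟨Z, hZ1, hZ⟩ := exists_comp_sub_bracket_eq_zero hX hres Y B
    refine ⟨Z, sub_eq_zero.1 (eq_zero_of_comp_eq_zero fun k => ?_)⟩
    by_cases hk : k = 1
    · subst hk
      -- The constant part of `Z` must be excluded first: paired with the quadratic part of `X` it
      -- would contribute to the degree one part of `[Z, X]`.
      have h0 := hZ 0 zero_ne_one
      rw [map_sub, hY, zero_sub, neg_eq_zero] at h0
      rw [map_sub, comp_bracket hX (mem_orderGEVF_one_of_bracket hX hres h0), hZ1, comp_one, hB,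
        sub_self]
    · exact hZ k hk

/-- The error of the degree by degree solution is concentrated in degree one. This gives
surjectivity of the maps onto `DH X` and `DHFol X`. -/
lemma exists_sub_linearField_mem_trivialDefs (hX : X ∈ orderGEVF K n 1)
    (hres : NonResonant (linearMatrix X)) (Y : VF K n) :
    ∃ B : Matrix (Fin n) (Fin n) K, Y - linearField B ∈ trivialDefs X := by
  obtain ⟨Z, -, hZ⟩ := exists_comp_sub_bracket_eq_zero hX hres Y 0
  refine ⟨linearMatrix (Y - bracket Z X), Z, ?_⟩
  rw [← eq_linearField_of_mem_homogVF_one (mem_homogVF_of_comp_eq_zero hZ), sub_sub_cancel]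

lemma linearField_mem_trivialDefs_iff (hX : X ∈ orderGEVF K n 1)
    (hres : NonResonant (linearMatrix X)) (B : Matrix (Fin n) (Fin n) K) :
    linearField B ∈ trivialDefs X ↔ ∃ C, C * linearMatrix X - linearMatrix X * C = B := by
  rw [mem_trivialDefs_iff hX hres
    (comp_eq_zero_of_mem_homogVF zero_ne_one (linearField_mem_homogVF B)),
    linearPart_linearField]
  simp only [linearPart, bracket_linearField_linearField, linearField_injective.eq_iff]
  constructor
  · rintro ⟨C, rfl⟩
    exact ⟨-C, by simp [sub_eq_neg_add, add_comm]⟩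
  · rintro ⟨C, rfl⟩
    exact ⟨-C, by simp [sub_eq_neg_add, add_comm]⟩

end Solve
end DefCoh
namespace DefCoh

open scoped Topology

/-! ### Dimensions of the cohomology spaces. -/

noncomputable section Cohomology

open MvPowerSeries

variable {K : Type*} [Field K] {n : ℕ}

/-- The linear vector field of a matrix, as a linear map. -/
def linearFieldHom (K : Type*) [Field K] (n : ℕ) : Matrix (Fin n) (Fin n) K →ₗ[K] VF K n where
  toFun := linearField
  map_add' A B := by
    funext j
    simp [linearField, add_smul, Finset.sum_add_distrib]
  map_smul' c A := by
    funext j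
    simp [linearField, Finset.smul_sum, smul_smul]

/-- The linear vector field of a matrix, as a linear map into `Z(X)`. -/
def linearInfDef (X : VF K n) : Matrix (Fin n) (Fin n) K →ₗ[K] infDefs X :=
  (linearFieldHom K n).codRestrict _ fun _ => infDefs_eq_top X ▸ Submodule.mem_top

/-- The linear vector field of a matrix, as a linear map into the linear part of `Z(X)`. -/
def linearInfDefLin (X : VF K n) :
    Matrix (Fin n) (Fin n) K →ₗ[K] (infDefs X ⊓ linearFields K n : Submodule K (VF K n)) :=
  (linearFieldHom K n).codRestrict _ fun A => ⟨(linearInfDef X A).2, A, rfl⟩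

lemma linearField_zero : linearField (0 : Matrix (Fin n) (Fin n) K) = 0 := by
  funext j
  simp [linearField]

lemma linearPart_mem_orderGEVF (X : VF K n) : linearPart X ∈ orderGEVF K n 1 :=
  homogVF_le_orderGEVF 1 (linearField_mem_homogVF _)

lemma linearMatrix_linearPart (X : VF K n) : linearMatrix (linearPart X) = linearMatrix X :=
  linearMatrix_linearField _

lemma det_ne_zero_of_nonResonant {A : Matrix (Fin n) (Fin n) K} (hA : NonResonant A) :
    A.det ≠ 0 := by
  intro h
  have h0 : (0 : AlgebraicClosure K) ∈ eigenvalues A := by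
    rw [← isRoot_charpoly_map_iff, Polynomial.IsRoot, Matrix.eval_charpoly, map_zero, zero_sub,
      Matrix.det_neg, ← RingHom.mapMatrix_apply, ← RingHom.map_det, h, map_zero, mul_zero]
  exact hA 0 h0 {0, 0} (by simpa using h0) (by simp) (by simp)

variable [CharZero K] {X : VF K n}

lemma linearField_mem_trivialDefs_iff_mem_range (hX : X ∈ orderGEVF K n 1)
    (hres : NonResonant (linearMatrix X)) (B : Matrix (Fin n) (Fin n) K) :
    linearField B ∈ trivialDefs X ↔
      B ∈ (intertwining K (linearMatrix X) (linearMatrix X)).range :=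
  linearField_mem_trivialDefs_iff hX hres B

/-- The commutator criterion for triviality involves only the linear part. This makes the comparison
map well defined and injective. -/
lemma linearField_mem_trivialDefs_linearPart_iff (hX : X ∈ orderGEVF K n 1)
    (hres : NonResonant (linearMatrix X)) (B : Matrix (Fin n) (Fin n) K) :
    linearField B ∈ trivialDefs (linearPart X) ↔ linearField B ∈ trivialDefs X := by
  rw [linearField_mem_trivialDefs_iff_mem_range hX hres,
    linearField_mem_trivialDefs_iff_mem_range (linearPart_mem_orderGEVF X)
      (by rwa [linearMatrix_linearPart]), linearMatrix_linearPart]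

/-- The inclusion of the linear vector fields induces an isomorphism in deformation cohomology. -/
theorem exists_linearEquiv_DHLin_DH (hX : X ∈ orderGEVF K n 1)
    (hres : NonResonant (linearMatrix X)) :
    ∃ e : DHLin (linearPart X) ≃ₗ[K] DH X, ∀ (Y : VF K n)
      (hY : Y ∈ infDefs (linearPart X) ⊓ linearFields K n), ∃ hY' : Y ∈ infDefs X,
        e (Submodule.Quotient.mk ⟨Y, hY⟩) = Submodule.Quotient.mk ⟨Y, hY'⟩ := by
  let ι : (infDefs (linearPart X) ⊓ linearFields K n : Submodule K (VF K n)) →ₗ[K] infDefs X :=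
    Submodule.inclusion (by rw [infDefs_eq_top X]; exact le_top)
  have hι : (trivialDefs (linearPart X) ⊓ linearFields K n).submoduleOf
      (infDefs (linearPart X) ⊓ linearFields K n) =
        ((trivialDefs X).submoduleOf (infDefs X)).comap ι := by
    ext ⟨Y, hY, B, hB⟩
    subst hB
    simp only [Submodule.submoduleOf, Submodule.mem_comap, Submodule.mem_inf,
      Submodule.subtype_apply, ι, Submodule.coe_inclusion,
      linearField_mem_trivialDefs_linearPart_iff hX hres]
    exact and_iff_left ⟨B, rfl⟩
  refine ⟨LinearEquiv.ofBijective (Submodule.mapQ _ _ ι hι.le) ⟨?_, ?_⟩,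
    fun Y hY => ⟨(ι ⟨Y, hY⟩).2, rfl⟩⟩
  · rw [← LinearMap.ker_eq_bot, Submodule.mapQ, Submodule.ker_liftQ, LinearMap.ker_comp,
      Submodule.ker_mkQ, ← hι, Submodule.mkQ_map_self]
  · intro y
    obtain ⟨⟨Y, hY⟩, rfl⟩ := Submodule.Quotient.mk_surjective _ y
    obtain ⟨B, hB⟩ := exists_sub_linearField_mem_trivialDefs hX hres Y
    refine ⟨Submodule.Quotient.mk (linearInfDefLin (linearPart X) B), ?_⟩
    refine ((Submodule.Quotient.eq _).2 ?_).symm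
    exact hB

/-- Matrices map onto `DHLin`, with the commutators with `A` as kernel. -/
lemma finite_and_finrank_DHLin (hX : X ∈ orderGEVF K n 1) (hres : NonResonant (linearMatrix X)) :
    Module.Finite K (DHLin (linearPart X)) ∧ Module.finrank K (DHLin (linearPart X)) +
      Module.finrank K (intertwining K (linearMatrix X) (linearMatrix X)).range = n ^ 2 := by
  let T : Matrix (Fin n) (Fin n) K →ₗ[K] DHLin (linearPart X) :=
    Submodule.mkQ _ ∘ₗ linearInfDefLin (linearPart X)
  have hT : Function.Surjective T := by
    intro y
    obtain ⟨⟨Y, hY, B, rfl⟩, rfl⟩ := Submodule.Quotient.mk_surjective _ y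
    exact ⟨B, rfl⟩
  have hker : T.ker = (intertwining K (linearMatrix X) (linearMatrix X)).range := by
    ext B
    rw [← linearField_mem_trivialDefs_iff_mem_range hX hres,
      ← linearField_mem_trivialDefs_linearPart_iff hX hres, LinearMap.ker_comp,
      Submodule.ker_mkQ]
    exact and_iff_left ⟨B, rfl⟩
  refine ⟨Module.Finite.of_surjective T hT, ?_⟩
  rw [← hker, ← finrank_top K (DHLin (linearPart X)), ← LinearMap.range_eq_top.2 hT,
    T.finrank_range_add_finrank_ker]
  simp [Module.finrank_matrix, sq]

/-- If `BA - AB = A`, then `B - A B A⁻¹ = 1`; the left side has trace `0`, the right side trace `n ≠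
0`. -/
lemma notMem_range_intertwining (hn : 1 ≤ n) {A : Matrix (Fin n) (Fin n) K}
    (hA : NonResonant A) : A ∉ (intertwining K A A).range := by
  rintro ⟨B, hB⟩
  have hdet : IsUnit A.det := isUnit_iff_ne_zero.2 (det_ne_zero_of_nonResonant hA)
  have h := congrArg (fun M => Matrix.trace (M * A⁻¹)) hB
  simp only [intertwining_apply, sub_mul, Matrix.mul_nonsing_inv _ hdet, mul_assoc, mul_one,
    Matrix.trace_sub, Matrix.trace_one, Fintype.card_fin] at h
  rw [Matrix.trace_mul_comm, mul_assoc, Matrix.nonsing_inv_mul _ hdet, mul_one, sub_self] at h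
  exact absurd h.symm (Nat.cast_ne_zero.2 (by omega))

lemma orderGEVF_two_le_trivialDefs (hX : X ∈ orderGEVF K n 1)
    (hres : NonResonant (linearMatrix X)) : orderGEVF K n 2 ≤ trivialDefs X := by
  intro Y hY
  rw [mem_trivialDefs_iff hX hres (comp_eq_zero_of_mem_orderGEVF two_pos hY)]
  exact ⟨0, by rw [← comp_one, comp_eq_zero_of_mem_orderGEVF one_lt_two hY, linearField_zero,
    bracket_zero_left]⟩

lemma linearField_mem_trivialFolDefs_iff (hX : X ∈ orderGEVF K n 1)
    (hres : NonResonant (linearMatrix X)) (B : Matrix (Fin n) (Fin n) K) :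
    linearField B ∈ trivialFolDefs X ↔
      B ∈ (intertwining K (linearMatrix X) (linearMatrix X)).range ⊔
        Submodule.span K {linearMatrix X} := by
  have key : ∀ f : Fun K n, f • X - linearField (constantCoeff f • linearMatrix X) ∈
      trivialDefs X := by
    intro f
    refine orderGEVF_two_le_trivialDefs hX hres ?_
    have hf : f - C (constantCoeff f) ∈ orderGE K n 1 := by
      intro d hd
      have h0 : d = 0 := (Finsupp.degree_eq_zero_iff d).1 (by omega)
      simp [h0]
    -- Both summands have order at least two: `f - f(0)` and `X` vanish at the origin, and `X -
    -- X⁽¹⁾` has no linear term.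
    have h : f • X - linearField (constantCoeff f • linearMatrix X) =
        (f - C (constantCoeff f)) • X + constantCoeff f • (X - comp 1 X) := by
      have h₁ : (C (constantCoeff f) : Fun K n) • X = constantCoeff f • X := by
        funext j
        simp [smul_eq_C_mul]
      have h₂ : linearField (constantCoeff f • linearMatrix X) = constantCoeff f • comp 1 X := by
        rw [comp_one]
        exact map_smul (linearFieldHom K n) _ _
      rw [sub_smul, h₁, h₂, smul_sub]
      abel
    rw [h]
    refine Submodule.add_mem _ (mem_orderGEVF.2 fun j => ?_)
      (Submodule.smul_mem _ _ (sub_comp_mem_orderGEVF hX))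
    exact mul_mem_orderGE hf (mem_orderGEVF.1 hX j)
  constructor
  · rintro ⟨Z, f, hZ⟩
    have h := (trivialDefs X).add_mem ⟨Z, rfl⟩ (key f)
    rw [← add_sub_assoc, ← hZ, ← linearField_sub,
      linearField_mem_trivialDefs_iff_mem_range hX hres] at h
    rw [← sub_add_cancel B (constantCoeff f • linearMatrix X)]
    exact Submodule.add_mem_sup h (Submodule.smul_mem _ _ (Submodule.mem_span_singleton_self _))
  · intro h
    obtain ⟨B', hB', _, hc, rfl⟩ := Submodule.mem_sup.1 h
    obtain ⟨c, rfl⟩ := Submodule.mem_span_singleton.1 hc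
    rw [← linearField_mem_trivialDefs_iff_mem_range hX hres] at hB'
    obtain ⟨Z, hZ⟩ := (trivialDefs X).sub_mem hB' (key (C c))
    refine ⟨Z, C c, ?_⟩
    rw [← hZ, constantCoeff_C, ← sub_add, sub_add_eq_add_sub, sub_add_cancel]
    exact map_add (linearFieldHom K n) _ _

/-- The kernel of the map from matrices is enlarged by the line through `A`, which meets the
commutators with `A` only in `0`; this accounts for the `1`. -/
lemma finite_and_finrank_DHFol (hn : 1 ≤ n) (hX : X ∈ orderGEVF K n 1)
    (hres : NonResonant (linearMatrix X)) :
    Module.Finite K (DHFol X) ∧ Module.finrank K (DHFol X) +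
      Module.finrank K (intertwining K (linearMatrix X) (linearMatrix X)).range + 1 = n ^ 2 := by
  let T : Matrix (Fin n) (Fin n) K →ₗ[K] DHFol X := Submodule.mkQ _ ∘ₗ linearInfDef X
  have hle : trivialDefs X ≤ trivialFolDefs X := by
    rintro _ ⟨Z, rfl⟩
    exact ⟨Z, 0, by simp⟩
  have hT : Function.Surjective T := by
    intro y
    obtain ⟨⟨Y, hY⟩, rfl⟩ := Submodule.Quotient.mk_surjective _ y
    obtain ⟨B, hB⟩ := exists_sub_linearField_mem_trivialDefs hX hres Y
    refine ⟨B, ((Submodule.Quotient.eq _).2 ?_).symm⟩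
    exact hle hB
  have hker : T.ker = (intertwining K (linearMatrix X) (linearMatrix X)).range ⊔
      Submodule.span K {linearMatrix X} := by
    ext B
    rw [← linearField_mem_trivialFolDefs_iff hX hres, LinearMap.ker_comp, Submodule.ker_mkQ]
    rfl
  have hA := notMem_range_intertwining hn hres
  have hA0 : linearMatrix X ≠ 0 := fun h => hA (h ▸ Submodule.zero_mem _)
  have hsup := Submodule.finrank_sup_add_finrank_inf_eq
    (intertwining K (linearMatrix X) (linearMatrix X)).range (Submodule.span K {linearMatrix X})
  rw [disjoint_iff.1 ((Submodule.disjoint_span_singleton' hA0).2 hA), finrank_bot,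
    finrank_span_singleton hA0, add_zero] at hsup
  refine ⟨Module.Finite.of_surjective T hT, ?_⟩
  rw [add_assoc, ← hsup, ← hker, ← finrank_top K (DHFol X), ← LinearMap.range_eq_top.2 hT,
    T.finrank_range_add_finrank_ker]
  simp [Module.finrank_matrix, sq]

end Cohomology
end DefCoh

theorem mainTheorem7 {K : Type*} [RCLike K] (n : ℕ) (hn : 1 ≤ n) (X : DefCoh.VF K n)
    (hX : ∀ j, MvPowerSeries.constantCoeff (X j) = 0)
    (hres : DefCoh.NonResonant (DefCoh.linearMatrix X)) :
    (∃ e : DefCoh.DHLin (DefCoh.linearPart X) ≃ₗ[K] DefCoh.DH X,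
      ∀ (Y : DefCoh.VF K n)
        (hY : Y ∈ DefCoh.infDefs (DefCoh.linearPart X) ⊓ DefCoh.linearFields K n),
        ∃ hY' : Y ∈ DefCoh.infDefs X,
          e (Submodule.Quotient.mk ⟨Y, hY⟩) = Submodule.Quotient.mk ⟨Y, hY'⟩) ∧
    Module.Finite K (DefCoh.DHLin (DefCoh.linearPart X)) ∧
    Module.Finite K (DefCoh.DHFol X) ∧
    (Module.finrank K (DefCoh.DHFol X) : ℤ) =
      (Module.finrank K (DefCoh.DHLin (DefCoh.linearPart X)) : ℤ) - 1 ∧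
    (∃ d : ℕ, DefCoh.AdjointOrbitHasDim (DefCoh.linearMatrix X) d ∧
      (Module.finrank K (DefCoh.DHLin (DefCoh.linearPart X)) : ℤ) = (n : ℤ) ^ 2 - (d : ℤ)) ∧
    n ≤ Module.finrank K (DefCoh.DHLin (DefCoh.linearPart X)) ∧
    ((DefCoh.eigenvalues (DefCoh.linearMatrix X)).Nodup →
      Module.finrank K (DefCoh.DHLin (DefCoh.linearPart X)) = n) := by
  have hX' := DefCoh.mem_orderGEVF_one hX
  obtain ⟨hfin, hdim⟩ := DefCoh.finite_and_finrank_DHLin hX' hres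
  obtain ⟨hfinF, hdimF⟩ := DefCoh.finite_and_finrank_DHFol hn hX' hres
  -- Rank-nullity turns `n² - d` into the dimension of the centralizer, to which the bounds of (ii)
  -- and (iii) apply.
  have hker := (DefCoh.intertwining K (DefCoh.linearMatrix X)
    (DefCoh.linearMatrix X)).finrank_range_add_finrank_ker
  rw [Module.finrank_matrix, Module.finrank_self, mul_one, Fintype.card_fin, ← sq] at hker
  have hle := DefCoh.le_finrank_ker_intertwining (DefCoh.linearMatrix X)
  refine ⟨DefCoh.exists_linearEquiv_DHLin_DH hX' hres, hfin, hfinF, by omega,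
    ⟨_, DefCoh.adjointOrbitHasDim _, ?_⟩, by omega, fun h => ?_⟩
  · rw [eq_sub_iff_add_eq]
    exact_mod_cast hdim
  · have := DefCoh.finrank_ker_intertwining_of_nodup h
    omega
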